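/- \textbf{Lemma (Conditional Worst Additive Noise Lemma).} Let $n\ge 1$ and let $X^n=(X_1,\dots,X_n)$ and $U^n=(U_1,\dots,U_n)$ be real random sequences on a common probability space, with an arbitrary joint law, each satisfying an average power constraint $\frac1n\sum_{j=1}^n\mathbb{E}[X_j^2]\le P_X<\infty$, $\frac1n\sum_{j=1}^n\mathbb{E}[U_j^2]\le P_U<\infty$. Let $Z^n=(Z_1,\dots,Z_n)$ be i.i.d. $\mathcal N(0,\sigma_Z^2)$, $\sigma_Z^2\ge 0$, and independent of the pair $(X^n,U^n)$. Let $K$ be a real $3\times 3$ matrix with $$\frac1n\sum_{j=1}^n \mathrm{Cov}(Z_j,\,X_j+Z_j,\,U_j)\preceq K ,$$ where $\mathrm{Cov}(\cdot)$ is the (centered) covariance matrix and $\preceq$ is the order given by positive semidefinite differences. Let $(Z,X_g+Z,U_g)$ be a zero-mean Gaussian random vector with covariance matrix $K$, where $Z\sim\mathcal N(0,\sigma_Z^2)$ has the law of the noise (so that $K_{11}=\sigma_Z^2$). For a random vector $A$ and a random variable or vector $B$ write $h(A|B)=-\mathbb E[\log p(A|B)]\in[-\infty,\infty)$ for the conditional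 differential entropy, where $p(a|b)$ is the conditional Lebesgue density of $A$ given $B$, and $h(A|B)=-\infty$ if there is no such density. Then $h(X^n|U^n)$, $h(X^n+Z^n|U^n)$, $h(X_g|U_g)$ and $h(X_g+Z|U_g)$ are all $<\infty$, the second and the fourth are finite if $\sigma_Z^2>0$, and $$h(X^n|U^n)-h(X^n+Z^n|U^n)\;\le\; n\,h(X_g|U_g)-n\,h(X_g+Z|U_g).$$ Equality holds if the pairs $(X_j,U_j)$, $j=1,\dots,n$, are i.i.d. copies of $(X_g,U_g)$. (If $\sigma_Z^2=0$, a difference $(-\infty)-(-\infty)$ is read as $-\infty$.) -/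

import Mathlib

open MeasureTheory ProbabilityTheory
open scoped NNReal ENNReal

/-- The density `p(x | u)` of `X` given `U` with respect to Lebesgue measure (the measure `volume`
of the space `E` of values of `X`), as a function of the pair `(u, x)`: the density of the joint
law of `(U, X)` with respect to the product of the law of `U` with Lebesgue measure.
It makes sense for an arbitrary law of `U`. -/
noncomputable def condDensity {Ω E F : Type*} [MeasurableSpace Ω] [MeasureSpace E]
    [MeasurableSpace F] (X : Ω → E) (U : Ω → F) (μ : Measure Ω) : F × E → ℝ≥0∞ :=
  (μ.map (fun ω => (U ω, X ω))).rnDeriv ((μ.map U).prod (volume : Measure E))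

/-- The conditional differential entropy `h(X | U) = - E[log p(X | U)]` in nats, as an extended
real number: the expectation of the positive part of `- log p(X | U)` minus the expectation of its
negative part, and `-∞` if `X` has no conditional density given `U`. -/
noncomputable def condDiffEntropy {Ω E F : Type*} [MeasurableSpace Ω] [MeasureSpace E]
    [MeasurableSpace F] (X : Ω → E) (U : Ω → F) (μ : Measure Ω) : EReal :=
  open Classical in
  if (μ.map (fun ω => (U ω, X ω))) ≪ (μ.map U).prod (volume : Measure E) then
    ((∫⁻ p, ENNReal.ofReal (-Real.log (condDensity X U μ p).toReal)
        ∂(μ.map (fun ω => (U ω, X ω))) : ℝ≥0∞) : EReal)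
      - ((∫⁻ p, ENNReal.ofReal (Real.log (condDensity X U μ p).toReal)
        ∂(μ.map (fun ω => (U ω, X ω))) : ℝ≥0∞) : EReal)
  else ⊥

/-- The random sequence `X^n` obeys the average power constraint `(1/n) ∑ⱼ E[Xⱼ²] ≤ P`. -/
def AvgPowerConstraint {Ω : Type*} [MeasurableSpace Ω] {n : ℕ} (X : Ω → Fin n → ℝ) (P : ℝ≥0)
    (μ : Measure Ω) : Prop :=
  ∑ j, ∫⁻ ω, ENNReal.ofReal (X ω j ^ 2) ∂μ ≤ (n : ℝ≥0∞) * (P : ℝ≥0∞)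

/-- The covariance matrix of a random vector. -/
noncomputable def covarianceMatrix {Ω ι : Type*} [MeasurableSpace Ω] (V : Ω → ι → ℝ)
    (μ : Measure Ω) : Matrix ι ι ℝ :=
  Matrix.of fun i k => covariance (fun ω => V ω i) (fun ω => V ω k) μ

/-! Write `Y = X + Z` and `s` for the noise variance. As `Z` is independent of `(X, U)`, formally
`h(X|U) - h(Y|U) = h(Z|Y,U) - h(Z)`, so the claim bounds the uncertainty left about the noise once
the sum and `U` are known. Cross entropy relative to any reference channel bounds `h(Z|Y,U)` from
above. The reference is the Gaussian posterior of `Z` that would be correct if `X - m(U)` were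
i.i.d. `N(0, v)`; its logarithm is quadratic, so only second moments enter, and the bound is `(n/2)
log (v / (v + s))`.

In `condDiffEntropy_sub_add_gaussian_le` this is one use of Gibbs' inequality, comparing the joint
density `p(x|u) φ(z)` with `q(x+z|u) r(z|x+z,u)`. Splitting the logarithms needs finite entropies:
second moments bound them above, the bounded noise density bounds `h(Y|U)` below, and `h(X|U) = -∞`
is trivial.

The matrix `K` enters as follows. Since its corner equals the noise variance, the positive
semidefinite difference has a zero diagonal entry, hence a zero column, and the Gaussian noise is
uncorrelated with `X_g` and `U_g` (`noise_column_eq`). Let `a` be the coefficient of `X_g` regressed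
on `U_g` and `v` the residual variance. The Gaussian entropies are then those of `N(0, v)` and `N(0,
v + s)` (`exists_gaussian_regression`), while the constraint evaluated at `(-1, 1, -a)` bounds the
average of `Var(X_j - a U_j)` by `v` (`sum_variance_residual_le`). This is the moment bound required
above, with `m` affine of slope `a`.

For i.i.d. copies of `(X_g, U_g)` the residuals are i.i.d. Gaussian and independent of `U`, so all
entropies are explicit. If `v = 0` the first entropies are `-∞`; if `s = 0` the sum is `X` almost
surely. -/

/-! ### Product Gaussian densities. -/

theorem pi_withDensity_ofReal {ι : Type*} [Fintype ι] (f : ι → ℝ → ℝ)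
    (hf : ∀ i, Integrable (f i)) (h0 : ∀ i x, 0 ≤ f i x)
    [∀ i, SigmaFinite ((volume : Measure ℝ).withDensity fun x => ENNReal.ofReal (f i x))] :
    Measure.pi (fun i => (volume : Measure ℝ).withDensity fun x => ENNReal.ofReal (f i x)) =
      (volume : Measure (ι → ℝ)).withDensity fun x => ∏ i, ENNReal.ofReal (f i (x i)) := by
  refine Measure.pi_eq fun s hs => ?_
  rw [withDensity_apply _ (MeasurableSet.univ_pi hs)]
  have e : (fun x : ι → ℝ => ∏ i, ENNReal.ofReal (f i (x i))) =
      fun x => ENNReal.ofReal (∏ i, f i (x i)) := by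
    ext x
    rw [ENNReal.ofReal_prod_of_nonneg fun i _ => h0 i _]
  rw [e, volume_pi, Measure.restrict_pi_pi, ← ofReal_integral_eq_lintegral_ofReal
    (Integrable.fintype_prod fun i => (hf i).restrict)
    (Filter.Eventually.of_forall fun x => Finset.prod_nonneg fun i _ => h0 i _),
    integral_fintype_prod_eq_prod,
    ENNReal.ofReal_prod_of_nonneg fun i _ => integral_nonneg fun x => h0 i x]
  refine Finset.prod_congr rfl fun i _ => ?_
  rw [withDensity_apply _ (hs i), ofReal_integral_eq_lintegral_ofReal (hf i).restrict
    (Filter.Eventually.of_forall fun x => h0 i x)]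

/-- The density of the law of a vector of independent real Gaussian variables with means `m j` and
common variance `v`. -/
noncomputable def gaussianPiPDF {ι : Type*} [Fintype ι] (m : ι → ℝ) (v : ℝ≥0) (x : ι → ℝ) : ℝ≥0∞ :=
  ∏ j, gaussianPDF (m j) v (x j)

theorem pi_gaussianReal {ι : Type*} [Fintype ι] (m : ι → ℝ) {v : ℝ≥0} (hv : v ≠ 0) :
    Measure.pi (fun j => gaussianReal (m j) v) =
      (volume : Measure (ι → ℝ)).withDensity (gaussianPiPDF m v) := by
  have h : ∀ j, gaussianReal (m j) v =
      (volume : Measure ℝ).withDensity fun x => ENNReal.ofReal (gaussianPDFReal (m j) v x) :=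
    fun j => gaussianReal_of_var_ne_zero _ hv
  have : ∀ j, SigmaFinite ((volume : Measure ℝ).withDensity
      fun x => ENNReal.ofReal (gaussianPDFReal (m j) v x)) := fun j => by
    rw [← h j]; infer_instance
  simp_rw [h]
  exact pi_withDensity_ofReal (fun j => gaussianPDFReal (m j) v)
    (fun j => integrable_gaussianPDFReal _ _) (fun j => gaussianPDFReal_nonneg _ _)

theorem lintegral_gaussianPiPDF {ι : Type*} [Fintype ι] (m : ι → ℝ) {v : ℝ≥0} (hv : v ≠ 0) :
    ∫⁻ x, gaussianPiPDF m v x = 1 := by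
  have h : (volume : Measure (ι → ℝ)).withDensity (gaussianPiPDF m v) Set.univ = 1 := by
    rw [← pi_gaussianReal m hv]; exact measure_univ
  rwa [withDensity_apply _ MeasurableSet.univ, Measure.restrict_univ] at h

theorem measurable_gaussianPiPDF_comp {α ι : Type*} [MeasurableSpace α] [Fintype ι]
    {m x : α → ι → ℝ} (hm : Measurable m) (hx : Measurable x) (v : ℝ≥0) :
    Measurable fun a => gaussianPiPDF (m a) v (x a) := by
  unfold gaussianPiPDF
  refine Finset.measurable_fun_prod _ fun j _ => ?_
  exact measurable_uncurry_gaussianPDF.comp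
    (((measurable_pi_apply j).comp hm).prodMk (measurable_const.prodMk ((measurable_pi_apply j).comp hx)))

theorem gaussianPiPDF_ne_zero {ι : Type*} [Fintype ι] (m : ι → ℝ) {v : ℝ≥0} (hv : v ≠ 0)
    (x : ι → ℝ) : gaussianPiPDF m v x ≠ 0 :=
  Finset.prod_ne_zero_iff.2 fun _ _ => (gaussianPDF_pos _ hv _).ne'

theorem gaussianPiPDF_ne_top {ι : Type*} [Fintype ι] (m : ι → ℝ) (v : ℝ≥0)
    (x : ι → ℝ) : gaussianPiPDF m v x ≠ ∞ :=
  ENNReal.prod_ne_top fun _ _ => gaussianPDF_ne_top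

theorem log_gaussianPDF (m : ℝ) {v : ℝ≥0} (hv : v ≠ 0) (x : ℝ) :
    Real.log (gaussianPDF m v x).toReal =
      -(Real.log (2 * Real.pi * v) / 2) - (x - m) ^ 2 / (2 * v) := by
  have hv' : (0 : ℝ) < v := by positivity
  rw [toReal_gaussianPDF, gaussianPDFReal, Real.log_mul (by positivity) (by positivity),
    Real.log_inv, Real.log_sqrt (by positivity), Real.log_exp]
  ring

theorem log_gaussianPiPDF {ι : Type*} [Fintype ι] (m : ι → ℝ) {v : ℝ≥0} (hv : v ≠ 0) (x : ι → ℝ) :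
    Real.log (gaussianPiPDF m v x).toReal =
      ∑ j, (-(Real.log (2 * Real.pi * v) / 2) - (x j - m j) ^ 2 / (2 * v)) := by
  rw [gaussianPiPDF, ENNReal.toReal_prod, Real.log_prod fun j _ =>
    (ENNReal.toReal_pos (gaussianPDF_pos _ hv _).ne' gaussianPDF_ne_top).ne']
  exact Finset.sum_congr rfl fun j _ => log_gaussianPDF _ hv _

/-- Boundedness of the noise density is what keeps the entropy of a noisy sum above `-∞`. -/
theorem gaussianPiPDF_le {ι : Type*} [Fintype ι] (m : ι → ℝ) (v : ℝ≥0) (x : ι → ℝ) :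
    gaussianPiPDF m v x ≤ ENNReal.ofReal ((√(2 * Real.pi * v))⁻¹) ^ Fintype.card ι := by
  refine Finset.prod_le_pow_card _ _ _ fun j _ => ENNReal.ofReal_le_ofReal ?_
  rw [gaussianPDFReal]
  refine mul_le_of_le_one_right (by positivity) (Real.exp_le_one_iff.2 ?_)
  exact div_nonpos_of_nonpos_of_nonneg (neg_nonpos.2 (sq_nonneg _)) (by positivity)

/-! ### Gibbs' inequality. -/

section Gibbs

variable {α : Type*} [MeasurableSpace α] {ν : Measure α} {f g : α → ℝ≥0∞}

/-- Only an inequality, because the mass of `g` on the zero set of `f` is lost. -/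
theorem lintegral_div_withDensity_le (hf : Measurable f) (hg : Measurable g)
    (hft : ∀ᵐ a ∂ν, f a < ∞) :
    ∫⁻ a, g a / f a ∂(ν.withDensity f) ≤ ∫⁻ a, g a ∂ν := by
  rw [lintegral_withDensity_eq_lintegral_mul _ hf (g := fun a => g a / f a) (hg.div hf)]
  refine lintegral_mono_ae (hft.mono fun a _ => ?_)
  exact ENNReal.mul_div_le

theorem log_sub_log_le {x y : ℝ≥0∞} (hx0 : x ≠ 0) (hx : x ≠ ∞) (hy0 : y ≠ 0) (hy : y ≠ ∞) :
    Real.log y.toReal - Real.log x.toReal ≤ (y / x).toReal - 1 := by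
  have h1 := ENNReal.toReal_pos hx0 hx
  have h2 := ENNReal.toReal_pos hy0 hy
  rw [← Real.log_div h2.ne' h1.ne', ENNReal.toReal_div]
  exact Real.log_le_sub_one_of_pos (div_pos h2 h1)

theorem ae_withDensity_ne_zero (hf : Measurable f) : ∀ᵐ a ∂(ν.withDensity f), f a ≠ 0 :=
  (ae_withDensity_iff hf).2 (Filter.Eventually.of_forall fun _ h => h)

/-- Follows from `log r ≤ r - 1` with no integrability assumption, so it can be used to establish
integrability. -/
theorem lintegral_ofReal_log_sub_log_le (hf : Measurable f) (hg : Measurable g)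
    (hft : ∀ᵐ a ∂ν, f a < ∞) (hg0 : ∀ᵐ a ∂(ν.withDensity f), g a ≠ 0)
    (hgt : ∀ᵐ a ∂(ν.withDensity f), g a ≠ ∞) (hg1 : ∫⁻ a, g a ∂ν ≤ 1) :
    ∫⁻ a, ENNReal.ofReal (Real.log (g a).toReal - Real.log (f a).toReal) ∂(ν.withDensity f)
      ≤ 1 := by
  refine le_trans (lintegral_mono_ae ?_) ((lintegral_div_withDensity_le hf hg hft).trans hg1)
  filter_upwards [hg0, hgt, ae_withDensity_ne_zero hf,
    (withDensity_absolutelyContinuous ν f).ae_le hft] with a h1 h2 h3 h4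
  refine (ENNReal.ofReal_le_ofReal (log_sub_log_le h3 h4.ne h1 h2)).trans ?_
  refine (ENNReal.ofReal_le_ofReal (sub_le_self _ zero_le_one)).trans ENNReal.ofReal_toReal_le

/-- **Gibbs' inequality**: cross entropy is at least entropy. -/
theorem integral_log_sub_log_nonpos [IsProbabilityMeasure (ν.withDensity f)]
    (hf : Measurable f) (hg : Measurable g)
    (hft : ∀ᵐ a ∂ν, f a < ∞) (hg0 : ∀ᵐ a ∂(ν.withDensity f), g a ≠ 0)
    (hgt : ∀ᵐ a ∂(ν.withDensity f), g a ≠ ∞) (hg1 : ∫⁻ a, g a ∂ν ≤ 1)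
    (hi : Integrable (fun a => Real.log (g a).toReal - Real.log (f a).toReal) (ν.withDensity f)) :
    ∫ a, (Real.log (g a).toReal - Real.log (f a).toReal) ∂(ν.withDensity f) ≤ 0 := by
  have hle := (lintegral_div_withDensity_le hf hg hft).trans hg1
  have hfin : ∀ᵐ a ∂(ν.withDensity f), g a / f a < ∞ :=
    ae_lt_top (hg.div hf) (hle.trans_lt ENNReal.one_lt_top).ne
  have hint : Integrable (fun a => (g a / f a).toReal) (ν.withDensity f) :=
    integrable_toReal_of_lintegral_ne_top (hg.div hf).aemeasurable
      (hle.trans_lt ENNReal.one_lt_top).ne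
  have h1 : ∫ a, (g a / f a).toReal ∂(ν.withDensity f) ≤ 1 := by
    rw [integral_toReal (f := fun a => g a / f a) (hg.div hf).aemeasurable hfin]
    exact ENNReal.toReal_le_of_le_ofReal zero_le_one (by simpa using hle)
  calc _ ≤ ∫ a, ((g a / f a).toReal - 1) ∂(ν.withDensity f) := by
        refine integral_mono_ae hi (hint.sub (integrable_const _)) ?_
        filter_upwards [hg0, hgt, ae_withDensity_ne_zero hf,
          (withDensity_absolutelyContinuous ν f).ae_le hft] with a h1 h2 h3 h4
        exact log_sub_log_le h3 h4.ne h1 h2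
    _ ≤ 0 := by
        rw [integral_sub hint (integrable_const _)]
        simpa using h1

end Gibbs

/-! ### Conditional entropy as an integral, and bounds from above. -/

section Entropy

variable {Ω E F : Type*} [MeasurableSpace Ω] [MeasureSpace E] [MeasurableSpace F]
  {μ : Measure Ω} {X X' : Ω → E} {U U' : Ω → F}

theorem condDiffEntropy_congr (hX : X =ᵐ[μ] X') (hU : U =ᵐ[μ] U') :
    condDiffEntropy X U μ = condDiffEntropy X' U' μ := by
  have h1 : μ.map (fun ω => (U ω, X ω)) = μ.map (fun ω => (U' ω, X' ω)) :=
    Measure.map_congr (by filter_upwards [hX, hU] with ω h1 h2; rw [h1, h2])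
  have h2 : μ.map U = μ.map U' := Measure.map_congr hU
  unfold condDiffEntropy condDensity
  rw [h1, h2]

theorem condDiffEntropy_eq_bot
    (h : ¬ (μ.map (fun ω => (U ω, X ω))) ≪ (μ.map U).prod (volume : Measure E)) :
    condDiffEntropy X U μ = ⊥ := by
  unfold condDiffEntropy
  rw [if_neg h]

theorem measurable_condDensity : Measurable (condDensity X U μ) :=
  Measure.measurable_rnDeriv _ _

theorem condDiffEntropy_eq_integral
    (h : (μ.map (fun ω => (U ω, X ω))) ≪ (μ.map U).prod (volume : Measure E))
    (hi : Integrable (fun p => Real.log (condDensity X U μ p).toReal)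
      (μ.map (fun ω => (U ω, X ω)))) :
    condDiffEntropy X U μ = ((-∫ p, Real.log (condDensity X U μ p).toReal
      ∂(μ.map (fun ω => (U ω, X ω))) : ℝ) : EReal) := by
  have h1 := hi.lintegral_lt_top
  have h2 := hi.neg.lintegral_lt_top
  unfold condDiffEntropy
  rw [if_pos h, integral_eq_lintegral_pos_part_sub_lintegral_neg_part hi, neg_sub,
    EReal.coe_sub]
  simp only [Pi.neg_apply] at h2
  rw [EReal.coe_ennreal_toReal h2.ne, EReal.coe_ennreal_toReal h1.ne]

theorem integrable_log_condDensity
    (hpos : ∫⁻ p, ENNReal.ofReal (-Real.log (condDensity X U μ p).toReal)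
        ∂(μ.map (fun ω => (U ω, X ω))) < ∞)
    (hneg : ∫⁻ p, ENNReal.ofReal (Real.log (condDensity X U μ p).toReal)
        ∂(μ.map (fun ω => (U ω, X ω))) < ∞) :
    Integrable (fun p => Real.log (condDensity X U μ p).toReal) (μ.map (fun ω => (U ω, X ω))) := by
  have hm : Measurable fun p => Real.log (condDensity X U μ p).toReal :=
    measurable_condDensity.ennreal_toReal.log
  refine ⟨hm.aestronglyMeasurable, ?_⟩
  rw [hasFiniteIntegral_iff_norm]
  calc ∫⁻ p, ENNReal.ofReal ‖Real.log (condDensity X U μ p).toReal‖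
        ∂(μ.map (fun ω => (U ω, X ω)))
      = ∫⁻ p, (ENNReal.ofReal (Real.log (condDensity X U μ p).toReal) +
          ENNReal.ofReal (-Real.log (condDensity X U μ p).toReal))
        ∂(μ.map (fun ω => (U ω, X ω))) := by
        refine lintegral_congr fun p => ?_
        rw [Real.norm_eq_abs]
        rcases le_total 0 (Real.log (condDensity X U μ p).toReal) with h0 | h0
        · rw [abs_of_nonneg h0, ENNReal.ofReal_of_nonpos (neg_nonpos.2 h0), add_zero]
        · rw [abs_of_nonpos h0, ENNReal.ofReal_of_nonpos h0, zero_add]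
    _ < ∞ := by
        rw [lintegral_add_left hm.ennreal_ofReal]
        exact ENNReal.add_lt_top.2 ⟨hneg, hpos⟩

/-- With a finite positive part, the only obstruction to integrability is an infinite negative part,
which makes the entropy `-∞`. -/
theorem condDiffEntropy_eq_bot_or_integrable
    (h : (μ.map (fun ω => (U ω, X ω))) ≪ (μ.map U).prod (volume : Measure E))
    (hpos : ∫⁻ p, ENNReal.ofReal (-Real.log (condDensity X U μ p).toReal)
        ∂(μ.map (fun ω => (U ω, X ω))) < ∞) :
    condDiffEntropy X U μ = ⊥ ∨ Integrable (fun p => Real.log (condDensity X U μ p).toReal)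
      (μ.map (fun ω => (U ω, X ω))) := by
  rcases eq_top_or_lt_top (∫⁻ p, ENNReal.ofReal (Real.log (condDensity X U μ p).toReal)
        ∂(μ.map (fun ω => (U ω, X ω)))) with hn | hn
  · left
    unfold condDiffEntropy
    rw [if_pos h, hn]
    exact EReal.sub_top _
  · exact Or.inr (integrable_log_condDensity hpos hn)

variable [IsProbabilityMeasure μ]

theorem map_eq_withDensity_condDensity [SigmaFinite (volume : Measure E)]
    (h : (μ.map (fun ω => (U ω, X ω))) ≪ (μ.map U).prod (volume : Measure E)) :
    ((μ.map U).prod (volume : Measure E)).withDensity (condDensity X U μ) =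
      μ.map (fun ω => (U ω, X ω)) :=
  Measure.withDensity_rnDeriv_eq _ _ h

theorem ae_condDensity_lt_top :
    ∀ᵐ p ∂((μ.map U).prod (volume : Measure E)), condDensity X U μ p < ∞ :=
  Measure.rnDeriv_lt_top _ _

/-- A reference density with integrable logarithm bounds the entropy from above. -/
theorem lintegral_neg_log_condDensity_lt_top [SigmaFinite (volume : Measure E)]
    (hX : AEMeasurable X μ) (hU : AEMeasurable U μ)
    (h : (μ.map (fun ω => (U ω, X ω))) ≪ (μ.map U).prod (volume : Measure E))
    {g : E → ℝ≥0∞} (hg : Measurable g) (hg0 : ∀ x, g x ≠ 0) (hgt : ∀ x, g x ≠ ∞)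
    (hg1 : ∫⁻ x, g x ≤ 1) (hi : Integrable (fun ω => Real.log (g (X ω)).toReal) μ) :
    ∫⁻ p, ENNReal.ofReal (-Real.log (condDensity X U μ p).toReal)
        ∂(μ.map (fun ω => (U ω, X ω))) < ∞ := by
  have : IsProbabilityMeasure (μ.map U) := Measure.isProbabilityMeasure_map hU
  have hgm : Measurable fun p : F × E => g p.2 := hg.comp measurable_snd
  have h1 := lintegral_ofReal_log_sub_log_le (ν := (μ.map U).prod (volume : Measure E))
    (measurable_condDensity (X := X) (U := U) (μ := μ)) hgm ae_condDensity_lt_top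
    (Filter.Eventually.of_forall fun p => hg0 p.2) (Filter.Eventually.of_forall fun p => hgt p.2)
    (by rw [lintegral_prod _ hgm.aemeasurable]; simpa using hg1)
  rw [map_eq_withDensity_condDensity h] at h1
  have h2 : ∫⁻ p, ENNReal.ofReal (-Real.log (g p.2).toReal) ∂(μ.map (fun ω => (U ω, X ω))) < ∞ := by
    rw [lintegral_map' (by fun_prop) (by fun_prop)]
    exact hi.neg.lintegral_lt_top
  calc _ ≤ ∫⁻ p, (ENNReal.ofReal (Real.log (g p.2).toReal -
          Real.log (condDensity X U μ p).toReal) + ENNReal.ofReal (-Real.log (g p.2).toReal))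
          ∂(μ.map (fun ω => (U ω, X ω))) := by
        refine lintegral_mono fun p => ?_
        refine le_trans (ENNReal.ofReal_le_ofReal ?_) ENNReal.ofReal_add_le
        linarith
    _ < ∞ := by
        rw [lintegral_add_right _ (by fun_prop)]
        exact ENNReal.add_lt_top.2 ⟨h1.trans_lt ENNReal.one_lt_top, h2⟩

theorem condDiffEntropy_lt_top [SigmaFinite (volume : Measure E)]
    (hX : AEMeasurable X μ) (hU : AEMeasurable U μ)
    {g : E → ℝ≥0∞} (hg : Measurable g) (hg0 : ∀ x, g x ≠ 0) (hgt : ∀ x, g x ≠ ∞)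
    (hg1 : ∫⁻ x, g x ≤ 1) (hi : Integrable (fun ω => Real.log (g (X ω)).toReal) μ) :
    condDiffEntropy X U μ < ⊤ := by
  by_cases h : (μ.map (fun ω => (U ω, X ω))) ≪ (μ.map U).prod (volume : Measure E)
  · have hp := lintegral_neg_log_condDensity_lt_top hX hU h hg hg0 hgt hg1 hi
    rcases condDiffEntropy_eq_bot_or_integrable h hp with h' | h'
    · rw [h']; exact bot_lt_top
    · rw [condDiffEntropy_eq_integral h h']
      exact EReal.coe_lt_top _
  · rw [condDiffEntropy_eq_bot h]
    exact bot_lt_top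

end Entropy

/-! ### Adding independent noise. -/

section Noise

variable {Ω E F : Type*} [MeasurableSpace Ω] [MeasureSpace E] [MeasurableSpace F]
  {μ : Measure Ω} [IsProbabilityMeasure μ] {X Z W : Ω → E} {U : Ω → F}

theorem condDensity_le [SigmaFinite (volume : Measure E)] {C : ℝ≥0∞} (hU : AEMeasurable U μ)
    (h : μ.map (fun ω => (U ω, X ω)) ≤ C • (μ.map U).prod (volume : Measure E)) :
    ∀ᵐ p ∂((μ.map U).prod (volume : Measure E)), condDensity X U μ p ≤ C := by
  have : IsProbabilityMeasure (μ.map U) := Measure.isProbabilityMeasure_map hU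
  refine ae_le_of_forall_setLIntegral_le_of_sigmaFinite measurable_condDensity fun s hs _ => ?_
  calc _ ≤ μ.map (fun ω => (U ω, X ω)) s := Measure.setLIntegral_rnDeriv_le s
    _ ≤ (C • (μ.map U).prod (volume : Measure E)) s := h s
    _ = _ := by simp

theorem lintegral_log_condDensity_lt_top [SigmaFinite (volume : Measure E)] {C : ℝ≥0∞}
    (hX : AEMeasurable X μ) (hU : AEMeasurable U μ) (hC : C ≠ ∞)
    (h : μ.map (fun ω => (U ω, X ω)) ≤ C • (μ.map U).prod (volume : Measure E)) :
    ∫⁻ p, ENNReal.ofReal (Real.log (condDensity X U μ p).toReal)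
        ∂(μ.map (fun ω => (U ω, X ω))) < ∞ := by
  have : IsProbabilityMeasure (μ.map (fun ω => (U ω, X ω))) :=
    Measure.isProbabilityMeasure_map (hU.prodMk hX)
  have hac := Measure.absolutelyContinuous_of_le_smul h
  calc _ ≤ ∫⁻ p, ENNReal.ofReal C.toReal ∂(μ.map (fun ω => (U ω, X ω))) := by
        refine lintegral_mono_ae ?_
        filter_upwards [hac.ae_le (condDensity_le hU h)] with p hp
        refine ENNReal.ofReal_le_ofReal ((Real.log_le_self ENNReal.toReal_nonneg).trans ?_)
        exact ENNReal.toReal_mono hC hp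
    _ < ∞ := by simp

variable [AddCommGroup E] [MeasurableAdd₂ E]
  [SigmaFinite (volume : Measure E)] [(volume : Measure E).IsAddLeftInvariant]

/-- Given `(X, U)`, the sum is a translate of the noise, whose law is at most `C` times the volume;
the volume is translation invariant, so the bound survives averaging over `X`. -/
theorem map_add_noise_le (hX : Measurable X) (hU : Measurable U) (hZ : Measurable Z)
    (hind : IndepFun Z (fun ω => (X ω, U ω)) μ) {φ : E → ℝ≥0∞}
    (hφ : μ.map Z = (volume : Measure E).withDensity φ) {C : ℝ≥0∞} (hC : ∀ z, φ z ≤ C) :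
    μ.map (fun ω => (U ω, X ω + Z ω)) ≤ C • (μ.map U).prod (volume : Measure E) := by
  have hXU : Measurable fun ω => (X ω, U ω) := hX.prodMk hU
  have : IsProbabilityMeasure (μ.map U) := Measure.isProbabilityMeasure_map hU.aemeasurable
  have : IsProbabilityMeasure (μ.map Z) := Measure.isProbabilityMeasure_map hZ.aemeasurable
  have hZle : μ.map Z ≤ C • (volume : Measure E) := by
    refine Measure.le_iff.2 fun s hs => ?_
    rw [hφ, withDensity_apply _ hs]
    exact (lintegral_mono fun z => hC z).trans (by simp)
  refine Measure.le_iff.2 fun s hs => ?_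
  have hT : Measurable fun q : (E × F) × E => (q.1.2, q.1.1 + q.2) := by fun_prop
  have e1 : μ.map (fun ω => (U ω, X ω + Z ω)) =
      ((μ.map fun ω => (X ω, U ω)).prod (μ.map Z)).map
        fun q : (E × F) × E => (q.1.2, q.1.1 + q.2) := by
    rw [← (indepFun_iff_map_prod_eq_prod_map_map hXU.aemeasurable hZ.aemeasurable).1 hind.symm,
      Measure.map_map hT (hXU.prodMk hZ)]
    rfl
  rw [e1, Measure.map_apply hT hs, Measure.prod_apply (hT hs), Measure.smul_apply,
    Measure.prod_apply hs, smul_eq_mul, lintegral_map (measurable_measure_prodMk_left (hT hs)) hXU,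
    lintegral_map (measurable_measure_prodMk_left hs) hU,
    ← lintegral_const_mul C (f := fun ω => volume (Prod.mk (U ω) ⁻¹' s))
      ((measurable_measure_prodMk_left hs).comp hU)]
  refine lintegral_mono fun ω => (hZle _).trans ?_
  rw [Measure.smul_apply, smul_eq_mul]
  refine mul_le_mul_right (le_of_eq ?_) _
  exact measure_preimage_add (volume : Measure E) (X ω) (Prod.mk (U ω) ⁻¹' s)

variable [MeasurableSub₂ E]

/-- The shear `(u, w) ↦ (u, m u + w)` translates each fibre and so preserves the reference measure.
-/
theorem map_add_indep_eq_withDensity (hW : AEMeasurable W μ) (hU : AEMeasurable U μ)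
    (hind : IndepFun U W μ) {f : E → ℝ≥0∞} (hf : Measurable f)
    (hlaw : μ.map W = (volume : Measure E).withDensity f) {m : F → E} (hm : Measurable m) :
    μ.map (fun ω => (U ω, m (U ω) + W ω)) =
      ((μ.map U).prod (volume : Measure E)).withDensity fun p => f (p.2 - m p.1) := by
  have : IsProbabilityMeasure (μ.map U) := Measure.isProbabilityMeasure_map hU
  have : IsProbabilityMeasure (μ.map W) := Measure.isProbabilityMeasure_map hW
  have hT : Measurable fun p : F × E => (p.1, m p.1 + p.2) := by fun_prop
  have hg : Measurable fun p : F × E => f (p.2 - m p.1) := by fun_prop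
  have e1 : μ.map (fun ω => (U ω, m (U ω) + W ω)) =
      ((μ.map U).prod (μ.map W)).map fun p : F × E => (p.1, m p.1 + p.2) := by
    rw [← (indepFun_iff_map_prod_eq_prod_map_map hU hW).1 hind,
      AEMeasurable.map_map_of_aemeasurable hT.aemeasurable (hU.prodMk hW)]
    rfl
  refine Measure.ext fun s hs => ?_
  rw [e1, Measure.map_apply hT hs, Measure.prod_apply (hT hs), withDensity_apply _ hs,
    ← lintegral_indicator hs, lintegral_prod _ (hg.indicator hs).aemeasurable]
  refine lintegral_congr fun u => ?_
  rw [hlaw, withDensity_apply _ (measurable_prodMk_left (hT hs)),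
    ← lintegral_indicator (measurable_prodMk_left (hT hs)),
    ← lintegral_add_left_eq_self
      (fun y => s.indicator (fun p : F × E => f (p.2 - m p.1)) (u, y)) (m u)]
  refine lintegral_congr fun w => ?_
  simp only [Set.indicator, add_sub_cancel_left]
  rfl

theorem condDiffEntropy_add_indep (hW : AEMeasurable W μ) (hU : AEMeasurable U μ)
    (hind : IndepFun U W μ) {f : E → ℝ≥0∞} (hf : Measurable f)
    (hlaw : μ.map W = (volume : Measure E).withDensity f) {m : F → E} (hm : Measurable m)
    (hi : Integrable (fun ω => Real.log (f (W ω)).toReal) μ) :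
    condDiffEntropy (fun ω => m (U ω) + W ω) U μ =
      ((-∫ ω, Real.log (f (W ω)).toReal ∂μ : ℝ) : EReal) := by
  have : IsProbabilityMeasure (μ.map U) := Measure.isProbabilityMeasure_map hU
  have hX : AEMeasurable (fun ω => (U ω, m (U ω) + W ω)) μ := by fun_prop
  have hg : Measurable fun p : F × E => f (p.2 - m p.1) := by fun_prop
  have hl : Measurable fun p : F × E => Real.log (f (p.2 - m p.1)).toReal := by fun_prop
  have e := map_add_indep_eq_withDensity hW hU hind hf hlaw hm
  have hac : μ.map (fun ω => (U ω, m (U ω) + W ω)) ≪ (μ.map U).prod (volume : Measure E) := by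
    rw [e]; exact withDensity_absolutelyContinuous _ _
  have hd : condDensity (fun ω => m (U ω) + W ω) U μ
      =ᵐ[(μ.map U).prod (volume : Measure E)] fun p => f (p.2 - m p.1) := by
    unfold condDensity
    rw [e]
    exact Measure.rnDeriv_withDensity _ hg
  have hlog : (fun p => Real.log (condDensity (fun ω => m (U ω) + W ω) U μ p).toReal)
      =ᵐ[μ.map (fun ω => (U ω, m (U ω) + W ω))] fun p => Real.log (f (p.2 - m p.1)).toReal := by
    filter_upwards [hac.ae_le hd] with p hp
    rw [hp]
  rw [condDiffEntropy_eq_integral hac, integral_congr_ae hlog,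
    integral_map hX hl.aestronglyMeasurable]
  · simp
  · rw [integrable_congr hlog, integrable_map_measure hl.aestronglyMeasurable hX]
    simpa [Function.comp_def] using hi

end Noise

/-- Gibbs' inequality pulled back to the sample space, with the two logarithms separately integrable
so that they can be split. -/
theorem integral_log_comp_le {Ω α : Type*} [MeasurableSpace Ω] [MeasurableSpace α]
    {μ : Measure Ω} [IsProbabilityMeasure μ] {ν : Measure α} {T : Ω → α} (hT : Measurable T)
    {f g : α → ℝ≥0∞} (hf : Measurable f) (hg : Measurable g) (hlaw : μ.map T = ν.withDensity f)
    (hft : ∀ᵐ a ∂ν, f a < ∞) (hg0 : ∀ᵐ ω ∂μ, g (T ω) ≠ 0) (hgt : ∀ᵐ ω ∂μ, g (T ω) ≠ ∞)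
    (hg1 : ∫⁻ a, g a ∂ν ≤ 1)
    (hfi : Integrable (fun ω => Real.log (f (T ω)).toReal) μ)
    (hgi : Integrable (fun ω => Real.log (g (T ω)).toReal) μ) :
    ∫ ω, Real.log (g (T ω)).toReal ∂μ ≤ ∫ ω, Real.log (f (T ω)).toReal ∂μ := by
  have hm : Measurable fun a => Real.log (g a).toReal - Real.log (f a).toReal := by fun_prop
  have : IsProbabilityMeasure (ν.withDensity f) := by
    rw [← hlaw]; exact Measure.isProbabilityMeasure_map hT.aemeasurable
  have h := integral_log_sub_log_nonpos hf hg hft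
    (by rw [← hlaw]
        exact (ae_map_iff hT.aemeasurable (measurableSet_eq_fun hg measurable_const).compl).2 hg0)
    (by rw [← hlaw]
        exact (ae_map_iff hT.aemeasurable (measurableSet_eq_fun hg measurable_const).compl).2 hgt)
    hg1
    (by rw [← hlaw, integrable_map_measure hm.aestronglyMeasurable hT.aemeasurable]
        exact hgi.sub hfi)
  rw [← hlaw, integral_map hT.aemeasurable hm.aestronglyMeasurable, integral_sub hgi hfi] at h
  linarith

/-- The mean square error of the linear estimate `t (D + Z)` of `Z`; independence and the centring
of `Z` kill the cross term. -/
theorem integral_sq_sub_mul_add_of_indepFun {Ω : Type*} [MeasurableSpace Ω] {μ : Measure Ω} [IsProbabilityMeasure μ]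
    {D Z : Ω → ℝ} (hD : MemLp D 2 μ) (hZ : MemLp Z 2 μ) (hind : IndepFun D Z μ)
    (hZ0 : ∫ ω, Z ω ∂μ = 0) (t : ℝ) :
    ∫ ω, (Z ω - t * (D ω + Z ω)) ^ 2 ∂μ =
      (1 - t) ^ 2 * ∫ ω, Z ω ^ 2 ∂μ + t ^ 2 * ∫ ω, D ω ^ 2 ∂μ := by
  have h1 : ∫ ω, D ω * Z ω ∂μ = 0 := by
    rw [hind.integral_fun_mul_eq_mul_integral hD.aestronglyMeasurable hZ.aestronglyMeasurable, hZ0,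
      mul_zero]
  have i1 : Integrable (fun ω => D ω * Z ω) μ := hD.integrable_mul hZ
  have e : ∀ ω, (Z ω - t * (D ω + Z ω)) ^ 2 =
      (1 - t) ^ 2 * Z ω ^ 2 + t ^ 2 * D ω ^ 2 - (2 * t * (1 - t)) * (D ω * Z ω) := fun ω => by ring
  have i2 := hZ.integrable_sq.const_mul ((1 - t) ^ 2)
  have i3 := hD.integrable_sq.const_mul (t ^ 2)
  have i4 : Integrable (fun ω => (1 - t) ^ 2 * Z ω ^ 2 + t ^ 2 * D ω ^ 2) μ := i2.add i3
  simp_rw [e]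
  rw [integral_sub i4 (i1.const_mul _), integral_add i2 i3,
    integral_const_mul, integral_const_mul, integral_const_mul, h1]
  ring

/-! ### Expected Gaussian log-densities. -/

section GaussianLog

variable {Ω ι : Type*} [MeasurableSpace Ω] [Fintype ι] {μ : Measure Ω} [IsProbabilityMeasure μ]

theorem integrable_log_gaussianPiPDF {X m : Ω → ι → ℝ} {v : ℝ≥0} (hv : v ≠ 0)
    (h : ∀ j, MemLp (fun ω => X ω j - m ω j) 2 μ) :
    Integrable (fun ω => Real.log (gaussianPiPDF (m ω) v (X ω)).toReal) μ := by
  simp_rw [log_gaussianPiPDF _ hv]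
  exact integrable_finsetSum _ fun j _ =>
    (integrable_const _).sub ((h j).integrable_sq.div_const _)

theorem integral_log_gaussianPiPDF {X m : Ω → ι → ℝ} {v : ℝ≥0} (hv : v ≠ 0)
    (h : ∀ j, MemLp (fun ω => X ω j - m ω j) 2 μ) :
    ∫ ω, Real.log (gaussianPiPDF (m ω) v (X ω)).toReal ∂μ =
      -(Fintype.card ι * (Real.log (2 * Real.pi * v) / 2)) -
        (∑ j, ∫ ω, (X ω j - m ω j) ^ 2 ∂μ) / (2 * v) := by
  have hi : ∀ j, Integrable
      (fun ω => -(Real.log (2 * Real.pi * v) / 2) - (X ω j - m ω j) ^ 2 / (2 * v)) μ := fun j =>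
    (integrable_const _).sub ((h j).integrable_sq.div_const _)
  simp_rw [log_gaussianPiPDF _ hv]
  rw [integral_finsetSum _ fun j _ => hi j]
  have : ∀ j, ∫ ω, (-(Real.log (2 * Real.pi * v) / 2) - (X ω j - m ω j) ^ 2 / (2 * v)) ∂μ =
      -(Real.log (2 * Real.pi * v) / 2) - (∫ ω, (X ω j - m ω j) ^ 2 ∂μ) / (2 * v) := fun j => by
    rw [integral_sub (integrable_const _) ((h j).integrable_sq.div_const _), integral_div]
    simp
  simp_rw [this, Finset.sum_sub_distrib, Finset.sum_div]
  simp

/-- The standard Gaussian serves as reference density: its logarithm is integrable by the second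
moments. -/
theorem condDiffEntropy_lt_top_of_memLp {F : Type*} [MeasurableSpace F] {X : Ω → ι → ℝ} {U : Ω → F}
    (hX : AEMeasurable X μ) (hU : AEMeasurable U μ) (h : ∀ j, MemLp (fun ω => X ω j) 2 μ) :
    condDiffEntropy X U μ < ⊤ :=
  condDiffEntropy_lt_top hX hU (g := gaussianPiPDF 0 1)
    (measurable_gaussianPiPDF_comp measurable_const measurable_id 1)
    (gaussianPiPDF_ne_zero _ one_ne_zero) (gaussianPiPDF_ne_top _ _)
    (lintegral_gaussianPiPDF _ one_ne_zero).le
    (integrable_log_gaussianPiPDF (m := fun _ => 0) one_ne_zero (by simpa using h))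

theorem lintegral_neg_log_condDensity_lt_top_of_memLp {F : Type*} [MeasurableSpace F]
    {X : Ω → ι → ℝ} {U : Ω → F} (hX : AEMeasurable X μ) (hU : AEMeasurable U μ)
    (h : ∀ j, MemLp (fun ω => X ω j) 2 μ)
    (hac : (μ.map (fun ω => (U ω, X ω))) ≪ (μ.map U).prod (volume : Measure (ι → ℝ))) :
    ∫⁻ p, ENNReal.ofReal (-Real.log (condDensity X U μ p).toReal)
        ∂(μ.map (fun ω => (U ω, X ω))) < ∞ :=
  lintegral_neg_log_condDensity_lt_top hX hU hac (g := gaussianPiPDF 0 1)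
    (measurable_gaussianPiPDF_comp measurable_const measurable_id 1)
    (gaussianPiPDF_ne_zero _ one_ne_zero) (gaussianPiPDF_ne_top _ _)
    (lintegral_gaussianPiPDF _ one_ne_zero).le
    (integrable_log_gaussianPiPDF (m := fun _ => 0) one_ne_zero (by simpa using h))

end GaussianLog

/-! ### The entropy inequality for a given residual second moment. -/

section WorstNoise

variable {Ω F ι : Type*} [MeasurableSpace Ω] [MeasurableSpace F] [Fintype ι]
  {μ : Measure Ω} [IsProbabilityMeasure μ] {X Z : Ω → ι → ℝ} {U : Ω → F} {s v : ℝ≥0}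

theorem absolutelyContinuous_add_gaussian (hX : Measurable X) (hU : Measurable U)
    (hZ : Measurable Z) (hind : IndepFun Z (fun ω => (X ω, U ω)) μ) (hs : s ≠ 0)
    (hZlaw : μ.map Z = Measure.pi fun _ => gaussianReal 0 s) :
    (μ.map (fun ω => (U ω, X ω + Z ω))) ≪ (μ.map U).prod (volume : Measure (ι → ℝ)) :=
  Measure.absolutelyContinuous_of_le_smul (map_add_noise_le hX hU hZ hind
    (hZlaw.trans (pi_gaussianReal 0 hs)) (gaussianPiPDF_le 0 s))

theorem integrable_log_condDensity_add_gaussian (hX : Measurable X) (hU : Measurable U)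
    (hZ : Measurable Z) (hind : IndepFun Z (fun ω => (X ω, U ω)) μ) (hs : s ≠ 0)
    (hZlaw : μ.map Z = Measure.pi fun _ => gaussianReal 0 s)
    (h2 : ∀ j, MemLp (fun ω => X ω j + Z ω j) 2 μ) :
    Integrable (fun p => Real.log (condDensity (fun ω => X ω + Z ω) U μ p).toReal)
      (μ.map (fun ω => (U ω, X ω + Z ω))) :=
  integrable_log_condDensity
    (lintegral_neg_log_condDensity_lt_top_of_memLp (hX.add hZ).aemeasurable hU.aemeasurable h2
      (absolutelyContinuous_add_gaussian hX hU hZ hind hs hZlaw))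
    (lintegral_log_condDensity_lt_top (hX.add hZ).aemeasurable hU.aemeasurable
      (ENNReal.pow_ne_top ENNReal.ofReal_ne_top) (map_add_noise_le hX hU hZ hind
    (hZlaw.trans (pi_gaussianReal 0 hs)) (gaussianPiPDF_le 0 s)))

theorem bot_lt_condDiffEntropy_add_gaussian (hX : Measurable X) (hU : Measurable U)
    (hZ : Measurable Z) (hind : IndepFun Z (fun ω => (X ω, U ω)) μ) (hs : s ≠ 0)
    (hZlaw : μ.map Z = Measure.pi fun _ => gaussianReal 0 s)
    (h2 : ∀ j, MemLp (fun ω => X ω j + Z ω j) 2 μ) :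
    ⊥ < condDiffEntropy (fun ω => X ω + Z ω) U μ := by
  rw [condDiffEntropy_eq_integral (absolutelyContinuous_add_gaussian hX hU hZ hind hs hZlaw)
    (integrable_log_condDensity_add_gaussian hX hU hZ hind hs hZlaw h2)]
  exact EReal.bot_lt_coe _

/-- The product of a conditional density of the sum and a Gaussian density of the noise given the
sum is a subprobability density of the summands. -/
theorem lintegral_posterior_le {P : Measure F} [IsProbabilityMeasure P]
    {q : F × (ι → ℝ) → ℝ≥0∞} (hq : Measurable q)
    (hq1 : ∫⁻ p, q p ∂(P.prod (volume : Measure (ι → ℝ))) ≤ 1)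
    {m : F → ι → ℝ} (hm : Measurable m) {w : ℝ≥0} (hw : w ≠ 0) (t : ℝ) :
    ∫⁻ a : (F × (ι → ℝ)) × (ι → ℝ), q (a.1.1, a.1.2 + a.2) *
        gaussianPiPDF (t • (a.1.2 + a.2 - m a.1.1)) w a.2
        ∂((P.prod volume).prod volume) ≤ 1 := by
  have hG : Measurable fun a : (F × (ι → ℝ)) × (ι → ℝ) =>
      q (a.1.1, a.1.2) * gaussianPiPDF (t • (a.1.2 - m a.1.1)) w a.2 :=
    (by fun_prop : Measurable fun a : (F × (ι → ℝ)) × (ι → ℝ) => q (a.1.1, a.1.2)).mul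
      (measurable_gaussianPiPDF_comp (by fun_prop) (by fun_prop) w)
  have hG' : Measurable fun a : (F × (ι → ℝ)) × (ι → ℝ) =>
      q (a.1.1, a.1.2 + a.2) * gaussianPiPDF (t • (a.1.2 + a.2 - m a.1.1)) w a.2 :=
    (by fun_prop : Measurable fun a : (F × (ι → ℝ)) × (ι → ℝ) => q (a.1.1, a.1.2 + a.2)).mul
      (measurable_gaussianPiPDF_comp (by fun_prop) (by fun_prop) w)
  calc _ = ∫⁻ a : (F × (ι → ℝ)) × (ι → ℝ), q (a.1.1, a.1.2) *
        gaussianPiPDF (t • (a.1.2 - m a.1.1)) w a.2 ∂((P.prod volume).prod volume) := by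
        -- With `z` outermost, `x` can be translated by `z` at fixed `(u, z)`.
        rw [lintegral_prod_symm _ hG'.aemeasurable, lintegral_prod_symm _ hG.aemeasurable]
        refine lintegral_congr fun z => ?_
        have h1 := lintegral_prod (μ := P) (ν := (volume : Measure (ι → ℝ))) _
          (hG'.comp (measurable_prodMk_right (y := z))).aemeasurable
        have h2 := lintegral_prod (μ := P) (ν := (volume : Measure (ι → ℝ))) _
          (hG.comp (measurable_prodMk_right (y := z))).aemeasurable
        refine h1.trans (Eq.trans ?_ h2.symm)
        refine lintegral_congr fun u => ?_
        exact lintegral_add_right_eq_self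
          (fun y => q (u, y) * gaussianPiPDF (t • (y - m u)) w z) z
    _ = ∫⁻ p, q p ∂(P.prod (volume : Measure (ι → ℝ))) := by
        -- Now `z` is integrated first, and the Gaussian factor has mass one.
        rw [lintegral_prod _ hG.aemeasurable]
        refine lintegral_congr fun p => ?_
        have h := lintegral_const_mul (μ := (volume : Measure (ι → ℝ))) (q p)
          (measurable_gaussianPiPDF_comp (measurable_const (a := t • (p.2 - m p.1)))
            measurable_id w)
        simp only [id_eq] at h
        rw [lintegral_gaussianPiPDF _ hw, mul_one] at h
        exact h
    _ ≤ 1 := hq1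

/-- Gibbs' inequality on triples `(u, x, z)`: the true density is compared with the conditional
density of the sum times a Gaussian guess for the noise given the sum and `u`. -/
theorem condDiffEntropy_sub_add_gaussian_le (hX : Measurable X) (hU : Measurable U)
    (hZ : Measurable Z) (hind : IndepFun Z (fun ω => (X ω, U ω)) μ) (hs : s ≠ 0) (hv : v ≠ 0)
    (hZlaw : μ.map Z = Measure.pi fun _ => gaussianReal 0 s)
    (hX2 : ∀ j, MemLp (fun ω => X ω j) 2 μ) {m : F → ι → ℝ} (hm : Measurable m)
    (hD2 : ∀ j, MemLp (fun ω => X ω j - m (U ω) j) 2 μ)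
    (hDv : ∑ j, ∫ ω, (X ω j - m (U ω) j) ^ 2 ∂μ ≤ Fintype.card ι * v) :
    condDiffEntropy X U μ - condDiffEntropy (fun ω => X ω + Z ω) U μ ≤
      ((Fintype.card ι * ((Real.log v - Real.log (v + s)) / 2) : ℝ) : EReal) := by
  by_cases hac : (μ.map (fun ω => (U ω, X ω))) ≪ (μ.map U).prod (volume : Measure (ι → ℝ))
  swap
  · rw [condDiffEntropy_eq_bot hac, EReal.bot_sub]; exact bot_le
  rcases condDiffEntropy_eq_bot_or_integrable hac
    (lintegral_neg_log_condDensity_lt_top_of_memLp hX.aemeasurable hU.aemeasurable hX2 hac)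
    with hb | hpi
  · rw [hb, EReal.bot_sub]; exact bot_le
  have hXU : Measurable fun ω => (U ω, X ω) := hU.prodMk hX
  have hYU : Measurable fun ω => (U ω, X ω + Z ω) := hU.prodMk (hX.add hZ)
  have : IsProbabilityMeasure (μ.map U) := Measure.isProbabilityMeasure_map hU.aemeasurable
  have hZj : ∀ j, HasLaw (fun ω => Z ω j) (gaussianReal 0 s) μ := fun j => by
    refine ⟨by fun_prop, ?_⟩
    have := (measurePreserving_eval (fun _ : ι => gaussianReal 0 s) j).map_eq
    rw [← hZlaw, Measure.map_map (measurable_pi_apply j) hZ] at this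
    exact this
  have hZ2 : ∀ j, MemLp (fun ω => Z ω j) 2 μ := fun j => by
    have h := memLp_id_gaussianReal' (μ := 0) (v := s) 2 (by simp)
    rw [← (hZj j).map_eq, memLp_map_measure_iff aestronglyMeasurable_id (hZj j).aemeasurable] at h
    exact h
  have hZ0 : ∀ j, ∫ ω, Z ω j ∂μ = 0 := fun j => by
    rw [(hZj j).integral_eq, integral_id_gaussianReal]
  have hZs : ∀ j, ∫ ω, Z ω j ^ 2 ∂μ = s := fun j => by
    have h1 := (hZj j).variance_eq
    rw [variance_id_gaussianReal, variance_of_integral_eq_zero (hZj j).aemeasurable (hZ0 j)] at h1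
    exact h1
  have hqac := absolutelyContinuous_add_gaussian hX hU hZ hind hs hZlaw
  have hqi := integrable_log_condDensity_add_gaussian hX hU hZ hind hs hZlaw
    fun j => (hX2 j).add (hZ2 j)
  rw [condDiffEntropy_eq_integral hac hpi, condDiffEntropy_eq_integral hqac hqi, ← EReal.coe_sub,
    EReal.coe_le_coe_iff]
  have hpm := measurable_condDensity (X := X) (U := U) (μ := μ)
  have hqm := measurable_condDensity (X := fun ω => X ω + Z ω) (U := U) (μ := μ)
  have hpt := ae_condDensity_lt_top (X := X) (U := U) (μ := μ)
  have hqt := ae_condDensity_lt_top (X := fun ω => X ω + Z ω) (U := U) (μ := μ)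
  have hpe := map_eq_withDensity_condDensity hac
  have hqe := map_eq_withDensity_condDensity hqac
  have hp0 : ∀ᵐ ω ∂μ, condDensity X U μ (U ω, X ω) ≠ 0 :=
    ae_of_ae_map hXU.aemeasurable (by rw [← hpe]; exact ae_withDensity_ne_zero hpm)
  have hp1 : ∀ᵐ ω ∂μ, condDensity X U μ (U ω, X ω) < ∞ :=
    ae_of_ae_map hXU.aemeasurable (hac.ae_le hpt)
  have hq0 : ∀ᵐ ω ∂μ, condDensity (fun ω => X ω + Z ω) U μ (U ω, X ω + Z ω) ≠ 0 :=
    ae_of_ae_map hYU.aemeasurable (by rw [← hqe]; exact ae_withDensity_ne_zero hqm)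
  have hq1 : ∀ᵐ ω ∂μ, condDensity (fun ω => X ω + Z ω) U μ (U ω, X ω + Z ω) < ∞ :=
    ae_of_ae_map hYU.aemeasurable (hqac.ae_le hqt)
  have hqmass : ∫⁻ p, condDensity (fun ω => X ω + Z ω) U μ p
      ∂((μ.map U).prod (volume : Measure (ι → ℝ))) ≤ 1 := by
    rw [← setLIntegral_univ, ← withDensity_apply _ MeasurableSet.univ, hqe]
    have := Measure.isProbabilityMeasure_map (μ := μ) hYU.aemeasurable
    exact prob_le_one
  have hlp := hpm.ennreal_toReal.log
  have hlq := hqm.ennreal_toReal.log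
  rw [integrable_map_measure hlp.aestronglyMeasurable hXU.aemeasurable] at hpi
  rw [integrable_map_measure hlq.aestronglyMeasurable hYU.aemeasurable] at hqi
  rw [integral_map hXU.aemeasurable hlp.aestronglyMeasurable,
    integral_map hYU.aemeasurable hlq.aestronglyMeasurable]
  simp only [Function.comp_def] at hpi hqi
  -- From here only the collected properties of the two conditional densities matter.
  generalize condDensity X U μ = p at *
  generalize condDensity (fun ω => X ω + Z ω) U μ = q at *
  have hs' : (0 : ℝ) < s := by positivity
  have hv' : (0 : ℝ) < v := by positivity
  -- If `X - m(U)` were `N(0, v)`, then `Z` given the sum `y` and `u` would be Gaussian with mean `t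
  -- (y - m u)` and variance `w` in each coordinate.
  obtain ⟨t, ht⟩ : ∃ t : ℝ, t = s / (s + v) := ⟨_, rfl⟩
  obtain ⟨w, hw⟩ : ∃ w : ℝ≥0, w = s * v / (s + v) := ⟨_, rfl⟩
  have hw0 : w ≠ 0 := by rw [hw]; positivity
  have hwr : (w : ℝ) = s * v / (s + v) := by rw [hw]; push_cast; rfl
  have hlawT : μ.map (fun ω => ((U ω, X ω), Z ω)) =
      (((μ.map U).prod (volume : Measure (ι → ℝ))).prod volume).withDensity
        fun a => p a.1 * gaussianPiPDF 0 s a.2 := by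
    have hi : IndepFun (fun ω => (U ω, X ω)) Z μ :=
      hind.symm.comp measurable_swap measurable_id
    rw [(indepFun_iff_map_prod_eq_prod_map_map hXU.aemeasurable hZ.aemeasurable).1 hi, ← hpe, hZlaw,
      show (Measure.pi fun _ : ι => gaussianReal 0 s) = _ from pi_gaussianReal 0 hs]
    have : SFinite ((volume : Measure (ι → ℝ)).withDensity (gaussianPiPDF 0 s)) := by
      rw [← pi_gaussianReal 0 hs]; infer_instance
    exact prod_withDensity hpm (measurable_gaussianPiPDF_comp measurable_const measurable_id s)
  have hZt : ∀ j, MemLp (fun ω => Z ω j - (t • (X ω + Z ω - m (U ω))) j) 2 μ := fun j => by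
    have := (hZ2 j).sub (((hD2 j).add (hZ2 j)).const_mul t)
    refine this.congr_norm (by fun_prop) (Filter.Eventually.of_forall fun ω => ?_)
    simp only [Pi.sub_apply, Pi.add_apply, Pi.smul_apply, smul_eq_mul]
    congr 1; ring
  have hri := integrable_log_gaussianPiPDF hw0 hZt
  have hφi := integrable_log_gaussianPiPDF (X := Z) (m := fun _ => 0) hs (by simpa using hZ2)
  have elr := integral_log_gaussianPiPDF hw0 hZt
  have elφ := integral_log_gaussianPiPDF (X := Z) (m := fun _ => 0) hs (by simpa using hZ2)
  have lf : (fun ω => Real.log (p (U ω, X ω) * gaussianPiPDF 0 s (Z ω)).toReal) =ᵐ[μ]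
      fun ω => Real.log (p (U ω, X ω)).toReal + Real.log (gaussianPiPDF 0 s (Z ω)).toReal := by
    filter_upwards [hp0, hp1] with ω h0 h1
    rw [ENNReal.toReal_mul, Real.log_mul (ENNReal.toReal_pos h0 h1.ne).ne'
      (ENNReal.toReal_pos (gaussianPiPDF_ne_zero _ hs _) (gaussianPiPDF_ne_top _ _ _)).ne']
  have lg : (fun ω => Real.log (q (U ω, X ω + Z ω) *
        gaussianPiPDF (t • (X ω + Z ω - m (U ω))) w (Z ω)).toReal) =ᵐ[μ]
      fun ω => Real.log (q (U ω, X ω + Z ω)).toReal +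
        Real.log (gaussianPiPDF (t • (X ω + Z ω - m (U ω))) w (Z ω)).toReal := by
    filter_upwards [hq0, hq1] with ω h0 h1
    rw [ENNReal.toReal_mul, Real.log_mul (ENNReal.toReal_pos h0 h1.ne).ne'
      (ENNReal.toReal_pos (gaussianPiPDF_ne_zero _ hw0 _) (gaussianPiPDF_ne_top _ _ _)).ne']
  have key := integral_log_comp_le (T := fun ω => ((U ω, X ω), Z ω)) (hXU.prodMk hZ)
    (f := fun a => p a.1 * gaussianPiPDF 0 s a.2)
    (g := fun a => q (a.1.1, a.1.2 + a.2) * gaussianPiPDF (t • (a.1.2 + a.2 - m a.1.1)) w a.2)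
    ((hpm.comp measurable_fst).mul (measurable_gaussianPiPDF_comp measurable_const measurable_snd s))
    ((by fun_prop : Measurable fun a : (F × (ι → ℝ)) × (ι → ℝ) => q (a.1.1, a.1.2 + a.2)).mul
      (measurable_gaussianPiPDF_comp (by fun_prop) (by fun_prop) w))
    hlawT
    (by
      have := Measure.quasiMeasurePreserving_fst (μ := (μ.map U).prod (volume : Measure (ι → ℝ)))
        (ν := (volume : Measure (ι → ℝ))) |>.ae hpt
      filter_upwards [this] with a ha
      exact ENNReal.mul_lt_top ha (gaussianPiPDF_ne_top _ _ _).lt_top)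
    (hq0.mono fun ω h => mul_ne_zero h (gaussianPiPDF_ne_zero _ hw0 _))
    (hq1.mono fun ω h => ENNReal.mul_ne_top h.ne (gaussianPiPDF_ne_top _ _ _))
    (lintegral_posterior_le hqm hqmass hm hw0 t)
    ((integrable_congr lf).2 (hpi.add hφi)) ((integrable_congr lg).2 (hqi.add hri))
  simp only at key
  rw [integral_congr_ae lf, integral_congr_ae lg, integral_add hpi hφi, integral_add hqi hri,
    elr, elφ] at key
  have hsum : ∑ j, ∫ ω, (Z ω j - (t • (X ω + Z ω - m (U ω))) j) ^ 2 ∂μ ≤ Fintype.card ι * w := by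
    have hj : ∀ j, ∫ ω, (Z ω j - (t • (X ω + Z ω - m (U ω))) j) ^ 2 ∂μ =
        (1 - t) ^ 2 * s + t ^ 2 * ∫ ω, (X ω j - m (U ω) j) ^ 2 ∂μ := fun j => by
      have hi : IndepFun (fun ω => X ω j - m (U ω) j) (fun ω => Z ω j) μ :=
        hind.symm.comp (φ := fun a : (ι → ℝ) × F => a.1 j - m a.2 j) (ψ := fun z : ι → ℝ => z j)
          (by fun_prop) (by fun_prop)
      rw [← hZs j, ← integral_sq_sub_mul_add_of_indepFun (hD2 j) (hZ2 j) hi (hZ0 j) t]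
      refine integral_congr_ae (Filter.Eventually.of_forall fun ω => ?_)
      simp only [Pi.sub_apply, Pi.add_apply, Pi.smul_apply, smul_eq_mul]
      ring
    simp_rw [hj, Finset.sum_add_distrib, ← Finset.mul_sum]
    -- The posterior variance is the error of the linear estimate at residual variance `v`. That
    -- error increases with the residual second moment, so the bound `hDv` suffices.
    have e : (w : ℝ) = (1 - t) ^ 2 * s + t ^ 2 * v := by
      rw [hwr, ht]; field_simp; ring
    rw [e, Finset.sum_const, Finset.card_univ, nsmul_eq_mul]
    nlinarith [mul_le_mul_of_nonneg_left hDv (sq_nonneg t)]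
  have hφsum : ∑ j, ∫ ω, (Z ω j - (0 : ι → ℝ) j) ^ 2 ∂μ = Fintype.card ι * s := by
    simp [hZs]
  rw [hφsum] at key
  have hw' : (0 : ℝ) < w := by positivity
  have h1 : (∑ j, ∫ ω, (Z ω j - (t • (X ω + Z ω - m (U ω))) j) ^ 2 ∂μ) / (2 * w) ≤
      Fintype.card ι / 2 := by
    rw [div_le_iff₀ (by positivity)]
    linarith
  have h2 : (Fintype.card ι * s : ℝ) / (2 * s) = Fintype.card ι / 2 := by
    field_simp
  rw [h2] at key
  -- The quadratic terms contribute at most `n/2 - n/2`, leaving the ratio `w / s = v / (v + s)`.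
  have h3 : Real.log (2 * Real.pi * w) - Real.log (2 * Real.pi * s) =
      Real.log v - Real.log (v + s) := by
    rw [Real.log_mul (by positivity) hw'.ne', Real.log_mul (by positivity) hs'.ne', hwr,
      Real.log_div (by positivity) (by positivity), Real.log_mul hs'.ne' hv'.ne', add_comm (s : ℝ) v]
    ring
  rw [← h3]
  linarith

end WorstNoise

/-! ### Second moments and covariance matrices. -/

section Covariance

variable {Ω ι : Type*} [MeasurableSpace Ω] {μ : Measure Ω}

theorem AvgPowerConstraint.memLp {n : ℕ} {X : Ω → Fin n → ℝ} {P : ℝ≥0}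
    (h : AvgPowerConstraint X P μ) (hX : Measurable X) (j : Fin n) :
    MemLp (fun ω => X ω j) 2 μ := by
  rw [memLp_two_iff_integrable_sq (by fun_prop)]
  refine ⟨by fun_prop, ?_⟩
  rw [hasFiniteIntegral_iff_ofReal (Filter.Eventually.of_forall fun _ => sq_nonneg _)]
  refine lt_of_le_of_lt ?_ (h.trans_lt (ENNReal.mul_lt_top (by simp) (by simp)))
  exact Finset.single_le_sum (f := fun j => ∫⁻ ω, ENNReal.ofReal (X ω j ^ 2) ∂μ)
    (fun _ _ => zero_le) (Finset.mem_univ j)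

variable [IsProbabilityMeasure μ]

theorem exists_covariance_sub_mul_eq_zero {X U : Ω → ℝ} (hX : MemLp X 2 μ) (hU : MemLp U 2 μ) :
    ∃ a : ℝ, covariance (fun ω => X ω - a * U ω) U μ = 0 := by
  refine ⟨covariance X U μ / variance U μ, ?_⟩
  rw [covariance_fun_sub_left hX (hU.const_mul _) hU, covariance_const_mul_left,
    covariance_self hU.aemeasurable]
  by_cases h : variance U μ = 0
  -- Here the quotient is `0` by convention, and `U` is almost surely constant, so the covariance
  -- vanishes anyway.
  · rw [h, mul_zero, sub_zero, covariance]
    refine integral_eq_zero_of_ae ?_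
    filter_upwards [ae_eq_integral_of_variance_eq_zero hU h] with ω hω
    simp [hω]
  · rw [div_mul_cancel₀ _ h, sub_self]

theorem covarianceMatrix_quadForm [Fintype ι] {V : Ω → ι → ℝ} (hV : ∀ i, MemLp (fun ω => V ω i) 2 μ)
    (x : ι → ℝ) :
    star x ⬝ᵥ (covarianceMatrix V μ).mulVec x = variance (fun ω => ∑ i, x i * V ω i) μ := by
  rw [variance_fun_sum fun i => (hV i).const_mul (x i)]
  simp only [dotProduct, Matrix.mulVec, star_trivial, covarianceMatrix, Matrix.of_apply,
    Finset.mul_sum]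
  refine Finset.sum_congr rfl fun i _ => Finset.sum_congr rfl fun j _ => ?_
  rw [covariance_const_mul_left, covariance_const_mul_right]
  ring

theorem covarianceMatrix_posSemidef [Fintype ι] {V : Ω → ι → ℝ}
    (hV : ∀ i, MemLp (fun ω => V ω i) 2 μ) : (covarianceMatrix V μ).PosSemidef := by
  refine Matrix.PosSemidef.of_dotProduct_mulVec_nonneg ?_ fun x => ?_
  · ext i j
    simp [covarianceMatrix, covariance_comm]
  · rw [covarianceMatrix_quadForm hV]
    exact variance_nonneg _ _

/-- A vector on which a positive semidefinite form vanishes lies in the kernel of the matrix; take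
the basis vector at `i`. -/
theorem posSemidef_apply_eq_zero {n : Type*} [Fintype n] [DecidableEq n] {M : Matrix n n ℝ}
    (hM : M.PosSemidef) {i : n} (h : M i i = 0) (j : n) : M j i = 0 := by
  have := (hM.dotProduct_mulVec_zero_iff (Pi.single i 1)).1 (by simp [h])
  simpa using congrFun this j

end Covariance

/-! ### Entropy `-∞` for laws on null fibres. -/

section Degenerate

variable {Ω E F : Type*} [MeasurableSpace Ω] [MeasureSpace E] [MeasurableSpace F]
  {μ : Measure Ω} [IsProbabilityMeasure μ] {X : Ω → E} {U : Ω → F}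

theorem condDiffEntropy_eq_bot_of_ae_mem (hX : AEMeasurable X μ) (hU : AEMeasurable U μ)
    [SFinite (volume : Measure E)] {S : Set (F × E)} (hS : MeasurableSet S)
    (h0 : ∀ u, volume (Prod.mk u ⁻¹' S) = 0) (h : ∀ᵐ ω ∂μ, (U ω, X ω) ∈ S) :
    condDiffEntropy X U μ = ⊥ := by
  refine condDiffEntropy_eq_bot fun hac => ?_
  have h1 : ((μ.map U).prod (volume : Measure E)) S = 0 := by
    rw [Measure.measure_prod_null hS]
    exact Filter.Eventually.of_forall h0
  have h2 := hac h1
  rw [Measure.map_apply_of_aemeasurable (hU.prodMk hX) hS] at h2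
  have h3 : ∀ᵐ ω ∂μ, False := by
    filter_upwards [h, measure_eq_zero_iff_ae_notMem.1 h2] with ω h1 h2 using h2 h1
  exact h3.exists.elim fun _ h => h

end Degenerate

/-! ### Exact entropies for Gaussian residuals. -/

section GaussianEntropy

variable {Ω ι : Type*} [MeasurableSpace Ω] {μ : Measure Ω}

theorem memLp_of_hasLaw_gaussianReal {W : Ω → ℝ} {m : ℝ} {v : ℝ≥0}
    (hW : HasLaw W (gaussianReal m v) μ) : MemLp W 2 μ := by
  have h := memLp_id_gaussianReal' (μ := m) (v := v) 2 (by simp)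
  rw [← hW.map_eq, memLp_map_measure_iff aestronglyMeasurable_id hW.aemeasurable] at h
  exact h

theorem integral_sq_of_hasLaw_gaussianReal {W : Ω → ℝ} {v : ℝ≥0}
    (hW : HasLaw W (gaussianReal 0 v) μ) : ∫ ω, W ω ^ 2 ∂μ = v := by
  have h0 : ∫ ω, W ω ∂μ = 0 := by rw [hW.integral_eq, integral_id_gaussianReal]
  have h1 := hW.variance_eq
  rwa [variance_id_gaussianReal, variance_of_integral_eq_zero hW.aemeasurable h0] at h1

theorem hasLaw_eval_of_pi [Fintype ι] {E : Type*} [MeasurableSpace E] {Z : Ω → ι → E}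
    (hZ : AEMeasurable Z μ) {ν : Measure E} [IsProbabilityMeasure ν]
    (h : μ.map Z = Measure.pi fun _ => ν) (j : ι) : HasLaw (fun ω => Z ω j) ν μ := by
  refine ⟨by fun_prop, ?_⟩
  have := (measurePreserving_eval (fun _ : ι => ν) j).map_eq
  rw [← h, AEMeasurable.map_map_of_aemeasurable (measurable_pi_apply j).aemeasurable hZ] at this
  exact this

theorem hasLaw_gaussianReal_of_integral_eq_zero {W : Ω → ℝ} (h : HasGaussianLaw W μ)
    (h0 : ∫ ω, W ω ∂μ = 0) : HasLaw W (gaussianReal 0 (variance W μ).toNNReal) μ :=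
  ⟨h.aemeasurable, by rw [h.map_eq_gaussianReal, h0]⟩

/-- The differential entropy of the Gaussian law with variance `v`. -/
noncomputable def gaussianEntropy (v : ℝ≥0) : ℝ := (Real.log (2 * Real.pi * v) + 1) / 2

variable [IsProbabilityMeasure μ]

theorem condDiffEntropy_add_gaussianReal {U W : Ω → ℝ} (hU : AEMeasurable U μ) {v : ℝ≥0} (hv : v ≠ 0)
    (hind : IndepFun U W μ) (hW : HasLaw W (gaussianReal 0 v) μ) (a : ℝ) :
    condDiffEntropy (fun ω => a * U ω + W ω) U μ = (gaussianEntropy v : EReal) := by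
  have hi : Integrable (fun ω => (W ω - 0) ^ 2 / (2 * v)) μ := by
    simpa using (memLp_of_hasLaw_gaussianReal hW).integrable_sq.div_const _
  rw [condDiffEntropy_add_indep hW.aemeasurable hU hind (measurable_gaussianPDF 0 v)
    (hW.map_eq.trans (gaussianReal_of_var_ne_zero _ hv)) (m := fun u => a * u) (by fun_prop)]
  · congr 1
    simp_rw [log_gaussianPDF 0 hv]
    rw [integral_sub (integrable_const _) hi, integral_div]
    simp only [sub_zero, integral_sq_of_hasLaw_gaussianReal hW, integral_const, probReal_univ,
      one_smul, gaussianEntropy]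
    have : (0 : ℝ) < v := by positivity
    field_simp
    ring
  · simp_rw [log_gaussianPDF 0 hv]
    exact (integrable_const _).sub hi

theorem condDiffEntropy_add_pi_gaussianReal [Fintype ι] {U W : Ω → ι → ℝ} (hU : AEMeasurable U μ)
    (hW : AEMeasurable W μ) {v : ℝ≥0} (hv : v ≠ 0)
    (hind : IndepFun U W μ) (hlaw : μ.map W = Measure.pi fun _ => gaussianReal 0 v) (a : ℝ) :
    condDiffEntropy (fun ω => a • U ω + W ω) U μ =
      (Fintype.card ι : EReal) * (gaussianEntropy v : EReal) := by
  have hj := hasLaw_eval_of_pi hW hlaw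
  have h2 : ∀ j, MemLp (fun ω => W ω j - (0 : ι → ℝ) j) 2 μ := fun j => by
    simpa using memLp_of_hasLaw_gaussianReal (hj j)
  rw [condDiffEntropy_add_indep hW hU hind
    (measurable_gaussianPiPDF_comp measurable_const measurable_id v)
    (hlaw.trans (pi_gaussianReal 0 hv)) (m := fun u => a • u) (by fun_prop)
    (integrable_log_gaussianPiPDF hv h2)]
  have hint := integral_log_gaussianPiPDF hv h2
  simp only [id_eq]
  rw [hint, show (Fintype.card ι : EReal) = ((Fintype.card ι : ℝ) : EReal) by simp, ← EReal.coe_mul]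
  congr 1
  have h3 : ∑ j, ∫ ω, (W ω j - (0 : ι → ℝ) j) ^ 2 ∂μ = Fintype.card ι * v := by
    simp [fun j => integral_sq_of_hasLaw_gaussianReal (hj j)]
  have : (0 : ℝ) < v := by positivity
  rw [h3, gaussianEntropy]
  field_simp
  ring

end GaussianEntropy

/-! ### Independence and laws of residual vectors. -/

section Independence

variable {Ω ι : Type*} [MeasurableSpace Ω] {μ : Measure Ω} [IsProbabilityMeasure μ] [Fintype ι]

/-- Independent pairs with a common product law have independent sequences of components. -/
theorem indepFun_and_map_of_iIndepFun_pairs {E F : Type*} [MeasurableSpace E] [MeasurableSpace F]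
    {A : Ω → ι → E} {B : Ω → ι → F} (hA : Measurable A) (hB : Measurable B)
    (h : iIndepFun (fun (j : ι) (ω : Ω) => (A ω j, B ω j)) μ)
    {α : Measure E} {β : Measure F} [IsProbabilityMeasure α] [IsProbabilityMeasure β]
    (hlaw : ∀ j, μ.map (fun ω => (A ω j, B ω j)) = α.prod β) :
    IndepFun A B μ ∧ μ.map B = Measure.pi fun _ => β := by
  have h1 : HasLaw (fun ω j => (A ω j, B ω j)) (Measure.pi fun _ : ι => α.prod β) μ :=
    h.hasLaw_pi fun j => ⟨by fun_prop, hlaw j⟩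
  have h2 := (measurePreserving_arrowProdEquivProdArrow E F ι (fun _ => α) (fun _ => β)).comp_hasLaw h1
  have h3 : μ.map (fun ω => (A ω, B ω)) = (Measure.pi fun _ => α).prod (Measure.pi fun _ => β) :=
    h2.map_eq
  have hBlaw : μ.map B = Measure.pi fun _ => β := by
    rw [← Measure.snd_map_prodMk (Y := B) hA, h3, Measure.snd_prod]
  have hAlaw : μ.map A = Measure.pi fun _ => α := by
    rw [← Measure.fst_map_prodMk (X := A) hB, h3, Measure.fst_prod]
  refine ⟨?_, hBlaw⟩
  rw [indepFun_iff_map_prod_eq_prod_map_map hA.aemeasurable hB.aemeasurable, h3, hAlaw, hBlaw]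

theorem map_add_pi_gaussianReal {D Z : Ω → ι → ℝ} (hD : Measurable D) (hZ : Measurable Z)
    (hind : IndepFun D Z μ) {v s : ℝ≥0}
    (hDlaw : μ.map D = Measure.pi fun _ => gaussianReal 0 v)
    (hZlaw : μ.map Z = Measure.pi fun _ => gaussianReal 0 s) :
    μ.map (fun ω => D ω + Z ω) = Measure.pi fun _ => gaussianReal 0 (v + s) := by
  have h1 : HasLaw (fun ω => (D ω, Z ω))
      ((Measure.pi fun _ : ι => gaussianReal 0 v).prod (Measure.pi fun _ => gaussianReal 0 s)) μ :=
    ⟨by fun_prop, by rw [(indepFun_iff_map_prod_eq_prod_map_map hD.aemeasurable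
      hZ.aemeasurable).1 hind, hDlaw, hZlaw]⟩
  have h2 := ((measurePreserving_arrowProdEquivProdArrow ℝ ℝ ι (fun _ => gaussianReal 0 v)
    (fun _ => gaussianReal 0 s)).symm).comp_hasLaw h1
  have h3 : μ.map (fun ω j => (D ω j, Z ω j)) =
      Measure.pi fun _ : ι => (gaussianReal 0 v).prod (gaussianReal 0 s) := h2.map_eq
  have h4 : μ.map (fun ω => D ω + Z ω) =
      (μ.map (fun ω j => (D ω j, Z ω j))).map fun x j => (x j).1 + (x j).2 := by
    rw [Measure.map_map (by fun_prop) (by fun_prop)]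
    rfl
  have h5 : ((gaussianReal 0 v).prod (gaussianReal 0 s)).map (fun x : ℝ × ℝ => x.1 + x.2) =
      gaussianReal 0 (v + s) := by
    have := gaussianReal_conv_gaussianReal (m₁ := 0) (m₂ := 0) (v₁ := v) (v₂ := s)
    rwa [add_zero] at this
  have : SigmaFinite (((gaussianReal 0 v).prod (gaussianReal 0 s)).map
    (fun x : ℝ × ℝ => x.1 + x.2)) := by rw [h5]; infer_instance
  rw [h4, h3, Measure.pi_map_pi (f := fun _ (x : ℝ × ℝ) => x.1 + x.2) (by fun_prop)]
  simp_rw [h5]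

/-- Both hypotheses together make the joint law of `U`, `D`, `Z` a triple product, which is then
reassociated. -/
theorem indepFun_prodMk_of_indepFun {E F G : Type*} [MeasurableSpace E] [MeasurableSpace F]
    [MeasurableSpace G] {U : Ω → E} {D : Ω → F} {Z : Ω → G} (hU : Measurable U) (hD : Measurable D)
    (hZ : Measurable Z) (h1 : IndepFun U D μ) (h2 : IndepFun (fun ω => (U ω, D ω)) Z μ) :
    IndepFun U (fun ω => (D ω, Z ω)) μ := by
  have h3 : IndepFun D Z μ := h2.comp measurable_snd measurable_id
  have := Measure.isProbabilityMeasure_map (μ := μ) hU.aemeasurable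
  have := Measure.isProbabilityMeasure_map (μ := μ) hD.aemeasurable
  have := Measure.isProbabilityMeasure_map (μ := μ) hZ.aemeasurable
  rw [indepFun_iff_map_prod_eq_prod_map_map (by fun_prop) (by fun_prop)] at h1 h2 h3 ⊢
  have e := (measurePreserving_prodAssoc (μ.map U) (μ.map D) (μ.map Z)).map_eq
  rw [h3, ← e, ← h1, ← h2, Measure.map_map (by fun_prop) (by fun_prop)]
  rfl

end Independence

/-! ### Linear regression in the Gaussian triple. -/

section GaussianRegression

variable {Ω : Type*} [MeasurableSpace Ω] {μ : Measure Ω} [IsProbabilityMeasure μ]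

/-- For a centred Gaussian vector `(Z, X + Z, U)` with `Z` uncorrelated with `X` and `U`, the
residuals of `X` and `X + Z` after linear regression on `U`. -/
theorem exists_gaussian_regression {Z X U : Ω → ℝ}
    (hG : HasGaussianLaw (fun ω => !₂[Z ω, X ω + Z ω, U ω]) μ)
    (h0 : ∫ ω, !₂[Z ω, X ω + Z ω, U ω] ∂μ = 0) {s : ℝ≥0}
    (hs : variance Z μ = s) (hZX : covariance Z X μ = 0) (hZU : covariance Z U μ = 0) :
    ∃ (a : ℝ) (v : ℝ≥0), variance (fun ω => X ω - a * U ω) μ = v ∧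
      IndepFun U (fun ω => X ω - a * U ω) μ ∧
      HasLaw (fun ω => X ω - a * U ω) (gaussianReal 0 v) μ ∧
      IndepFun U (fun ω => X ω + Z ω - a * U ω) μ ∧
      HasLaw (fun ω => X ω + Z ω - a * U ω) (gaussianReal 0 (v + s)) μ := by
  -- Joint Gaussianity of `U` with any combination turns zero covariance into independence. The
  -- choices `(-1, 1, -a)` and `(0, 1, -a)` give the two residuals.
  have hcomb : ∀ c d e : ℝ, HasGaussianLaw
      (fun ω => (U ω, c * Z ω + d * (X ω + Z ω) + e * U ω)) μ := fun c d e => by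
    let L : EuclideanSpace ℝ (Fin 3) →L[ℝ] ℝ × ℝ := (EuclideanSpace.proj 2).prod
      (c • EuclideanSpace.proj 0 + d • EuclideanSpace.proj 1 + e • EuclideanSpace.proj 2)
    simpa [L] using hG.map_fun L
  have hint : ∀ c d e : ℝ, ∫ ω, (c * Z ω + d * (X ω + Z ω) + e * U ω) ∂μ = 0 := fun c d e => by
    have := (c • EuclideanSpace.proj 0 + d • EuclideanSpace.proj 1 + e • EuclideanSpace.proj 2 :
      EuclideanSpace ℝ (Fin 3) →L[ℝ] ℝ).integral_comp_comm hG.integrable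
    rw [h0] at this
    simpa using this
  have hU2 : MemLp U 2 μ := (hcomb 0 0 0).fst.memLp_two
  have hZ2 : MemLp Z 2 μ := by simpa using (hcomb 1 0 0).snd.memLp_two
  have hX2 : MemLp X 2 μ := by simpa using (hcomb (-1) 1 0).snd.memLp_two
  obtain ⟨a, ha⟩ := exists_covariance_sub_mul_eq_zero hX2 hU2
  have hW2 : MemLp (fun ω => X ω - a * U ω) 2 μ := hX2.sub (hU2.const_mul a)
  have e1 : ∀ ω, -1 * Z ω + 1 * (X ω + Z ω) + -a * U ω = X ω - a * U ω := fun ω => by ring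
  have e2 : ∀ ω, 0 * Z ω + 1 * (X ω + Z ω) + -a * U ω = X ω + Z ω - a * U ω := fun ω => by ring
  have e3 : (fun ω => X ω + Z ω - a * U ω) = fun ω => (X ω - a * U ω) + Z ω := by
    ext ω; ring
  have hWZ : covariance (fun ω => X ω - a * U ω) Z μ = 0 := by
    rw [covariance_fun_sub_left hX2 (hU2.const_mul a) hZ2, covariance_const_mul_left,
      covariance_comm, hZX, covariance_comm, hZU, mul_zero, sub_zero]
  have g1 := hcomb (-1) 1 (-a)
  have g2 := hcomb 0 1 (-a)
  have i1 := hint (-1) 1 (-a)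
  have i2 := hint 0 1 (-a)
  simp_rw [e1] at g1 i1
  simp_rw [e2] at g2 i2
  refine ⟨a, (variance (fun ω => X ω - a * U ω) μ).toNNReal,
    (Real.coe_toNNReal _ (variance_nonneg _ _)).symm, ?_, ?_, ?_, ?_⟩
  · refine g1.indepFun_of_covariance_eq_zero ?_
    rw [covariance_comm, ha]
  · exact hasLaw_gaussianReal_of_integral_eq_zero g1.snd i1
  · refine g2.indepFun_of_covariance_eq_zero ?_
    have h := covariance_add_left hW2 hZ2 hU2
    rw [ha, hZU, add_zero] at h
    rw [covariance_comm, e3]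
    exact h
  · have := hasLaw_gaussianReal_of_integral_eq_zero g2.snd i2
    have hv := variance_fun_add hW2 hZ2
    rw [hWZ, mul_zero, add_zero, hs] at hv
    rw [e3] at this ⊢
    rwa [hv, Real.toNNReal_add (variance_nonneg _ _) (NNReal.coe_nonneg s), Real.toNNReal_coe] at this

end GaussianRegression

/-! ### Consequences of the covariance constraint. -/

section Residual

variable {Ω : Type*} [MeasurableSpace Ω] {μ : Measure Ω} {n : ℕ}
  {X U Z : Ω → Fin n → ℝ} {K : Matrix (Fin 3) (Fin 3) ℝ}

theorem memLp_triple {Z X U : Ω → ℝ} (hZ : MemLp Z 2 μ) (hX : MemLp X 2 μ) (hU : MemLp U 2 μ)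
    (i : Fin 3) : MemLp (fun ω => ![Z ω, X ω + Z ω, U ω] i) 2 μ := by
  fin_cases i
  · exact hZ
  · exact hX.add hZ
  · exact hU

variable [IsProbabilityMeasure μ]

theorem covarianceMatrix_quadForm_residual {Z X U : Ω → ℝ} (hZ : MemLp Z 2 μ) (hX : MemLp X 2 μ)
    (hU : MemLp U 2 μ) (a : ℝ) :
    star ![-1, 1, -a] ⬝ᵥ
      (covarianceMatrix (fun ω => ![Z ω, X ω + Z ω, U ω]) μ).mulVec ![-1, 1, -a] =
      variance (fun ω => X ω - a * U ω) μ := by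
  rw [covarianceMatrix_quadForm (memLp_triple hZ hX hU)]
  congr 1
  ext ω
  simp only [Fin.sum_univ_three, Matrix.cons_val]
  ring

/-- The quadratic form of the covariance constraint at `(-1, 1, -a)`. -/
theorem sum_variance_residual_le (hn : 0 < n) (hX : ∀ j, MemLp (fun ω => X ω j) 2 μ)
    (hU : ∀ j, MemLp (fun ω => U ω j) 2 μ) (hZ : ∀ j, MemLp (fun ω => Z ω j) 2 μ)
    (hK : (K - (n : ℝ)⁻¹ •
      ∑ j, covarianceMatrix (fun ω => ![Z ω j, X ω j + Z ω j, U ω j]) μ).PosSemidef) (a : ℝ) :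
    ∑ j, variance (fun ω => X ω j - a * U ω j) μ ≤
      n * (star ![-1, 1, -a] ⬝ᵥ K.mulVec ![-1, 1, -a]) := by
  have h := hK.dotProduct_mulVec_nonneg ![-1, 1, -a]
  rw [Matrix.sub_mulVec, Matrix.smul_mulVec, Matrix.sum_mulVec, dotProduct_sub, dotProduct_smul,
    dotProduct_sum] at h
  simp_rw [fun j => covarianceMatrix_quadForm_residual (hZ j) (hX j) (hU j) a] at h
  have hn' : (0 : ℝ) < n := by exact_mod_cast hn
  rw [sub_nonneg, smul_eq_mul, inv_mul_le_iff₀ hn'] at h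
  exact h

/-- `K` is the positive semidefinite difference plus an average of covariance matrices. This is
needed for `multivariateGaussian 0 K` to have covariance `K`. -/
theorem posSemidef_of_covariance_le (hX : ∀ j, MemLp (fun ω => X ω j) 2 μ)
    (hU : ∀ j, MemLp (fun ω => U ω j) 2 μ) (hZ : ∀ j, MemLp (fun ω => Z ω j) 2 μ)
    (hK : (K - (n : ℝ)⁻¹ •
      ∑ j, covarianceMatrix (fun ω => ![Z ω j, X ω j + Z ω j, U ω j]) μ).PosSemidef) :
    K.PosSemidef := by
  have h := hK.add ((Matrix.posSemidef_sum Finset.univ fun j _ => covarianceMatrix_posSemidef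
    (memLp_triple (hZ j) (hX j) (hU j))).smul (inv_nonneg.2 (Nat.cast_nonneg (α := ℝ) n)))
  simpa using h

/-- If the noise variance in the covariance constraint is attained, so are the covariances with the
noise. -/
theorem noise_column_eq (hn : 0 < n) (hX : ∀ j, MemLp (fun ω => X ω j) 2 μ)
    (hZ : ∀ j, MemLp (fun ω => Z ω j) 2 μ)
    (hZX : ∀ j, covariance (fun ω => X ω j) (fun ω => Z ω j) μ = 0)
    (hZU : ∀ j, covariance (fun ω => U ω j) (fun ω => Z ω j) μ = 0) {s : ℝ}
    (hs : ∀ j, variance (fun ω => Z ω j) μ = s)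
    (hK : (K - (n : ℝ)⁻¹ •
      ∑ j, covarianceMatrix (fun ω => ![Z ω j, X ω j + Z ω j, U ω j]) μ).PosSemidef)
    (hK0 : K 0 0 = s) : K 1 0 = s ∧ K 2 0 = 0 := by
  have hn' : (n : ℝ) ≠ 0 := by exact_mod_cast hn.ne'
  have e0 : ∀ j, covariance (fun ω => Z ω j) (fun ω => Z ω j) μ = s := fun j => by
    rw [covariance_self (hZ j).aemeasurable, hs]
  have e1 : ∀ j, covariance (fun ω => X ω j + Z ω j) (fun ω => Z ω j) μ = s := fun j => by
    have h := covariance_add_left (hX j) (hZ j) (hZ j)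
    rw [hZX, e0, zero_add] at h
    exact h
  have h00 : (K - (n : ℝ)⁻¹ •
      ∑ j, covarianceMatrix (fun ω => ![Z ω j, X ω j + Z ω j, U ω j]) μ) 0 0 = 0 := by
    simp [Matrix.sum_apply, covarianceMatrix, e0, hK0, hn']
  have h1 := posSemidef_apply_eq_zero hK h00 1
  have h2 := posSemidef_apply_eq_zero hK h00 2
  simp [Matrix.sum_apply, covarianceMatrix, e1, hn'] at h1
  simp [Matrix.sum_apply, covarianceMatrix, hZU] at h2
  exact ⟨by linarith, h2⟩

end Residual

/-! ### The case of i.i.d. pairs. -/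

section Equality

variable {Ω Ω' : Type*} [MeasurableSpace Ω] [MeasurableSpace Ω'] {μ : Measure Ω}
  [IsProbabilityMeasure μ] {μ' : Measure Ω'} [IsProbabilityMeasure μ'] {n : ℕ}

/-- Each pair `(U_j, X_j - a U_j)` inherits the product law of `U_g` and its Gaussian residual. -/
theorem residual_of_iid {X U : Ω → Fin n → ℝ} (hX : Measurable X) (hU : Measurable U)
    {Xg Ug : Ω' → ℝ} (hUg : AEMeasurable Ug μ') {a : ℝ} {v : ℝ≥0}
    (hind : IndepFun Ug (fun ω => Xg ω - a * Ug ω) μ')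
    (hW : HasLaw (fun ω => Xg ω - a * Ug ω) (gaussianReal 0 v) μ')
    (hi : iIndepFun (fun (j : Fin n) (ω : Ω) => (X ω j, U ω j)) μ)
    (hd : ∀ j, IdentDistrib (fun ω => (X ω j, U ω j)) (fun ω => (Xg ω, Ug ω)) μ μ') :
    IndepFun U (fun ω => X ω - a • U ω) μ ∧
      μ.map (fun ω => X ω - a • U ω) = Measure.pi fun _ => gaussianReal 0 v := by
  have := Measure.isProbabilityMeasure_map hUg
  have hT : Measurable fun p : ℝ × ℝ => (p.2, p.1 - a * p.2) := by fun_prop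
  refine indepFun_and_map_of_iIndepFun_pairs hU (by fun_prop)
    (hi.comp (fun _ p => (p.2, p.1 - a * p.2)) fun _ => hT) (α := μ'.map Ug) fun j => ?_
  have h1 := ((hd j).comp hT).map_eq
  rw [← hW.map_eq, ← (indepFun_iff_map_prod_eq_prod_map_map hUg hW.aemeasurable).1 hind]
  exact h1

end Equality

/-! ### The conditional worst additive noise lemma. -/

theorem mainTheorem4
    {Ω Ω' : Type*} [MeasurableSpace Ω] [MeasurableSpace Ω']
    (μ : Measure Ω) [IsProbabilityMeasure μ] (μ' : Measure Ω') [IsProbabilityMeasure μ']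
    (n : ℕ) (hn : 0 < n)
    -- the random sequences `X^n`, `U^n` (arbitrarily dependent) and the noise `Z^n`
    (X U Z : Ω → Fin n → ℝ) (hX : Measurable X) (hU : Measurable U) (hZ : Measurable Z)
    (PX PU : ℝ≥0) (hPX : AvgPowerConstraint X PX μ) (hPU : AvgPowerConstraint U PU μ)
    -- `Z^n` is i.i.d. `N(0, σ²)` and independent of `(X^n, U^n)`
    (σsq : ℝ≥0)
    (hZlaw : ∀ j, HasLaw (fun ω => Z ω j) (gaussianReal 0 σsq) μ)
    (hZiid : iIndepFun (fun (j : Fin n) (ω : Ω) => Z ω j) μ)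
    (hZXU : IndepFun Z (fun ω => (X ω, U ω)) μ)
    -- the average covariance constraint
    (K : Matrix (Fin 3) (Fin 3) ℝ)
    (hK : (K - (n : ℝ)⁻¹ •
      ∑ j, covarianceMatrix (fun ω => ![Z ω j, X ω j + Z ω j, U ω j]) μ).PosSemidef)
    -- the Gaussian vector `(Z, X_g + Z, U_g)` with covariance `K`, where `Z` is again `N(0, σ²)`
    (Zg Xg Ug : Ω' → ℝ)
    (hg : HasLaw (fun ω => !₂[Zg ω, Xg ω + Zg ω, Ug ω]) (multivariateGaussian 0 K) μ')
    (hZg : HasLaw Zg (gaussianReal 0 σsq) μ') :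
    -- the entropies are smaller than `∞`, and the subtracted ones are finite for proper noise
    (condDiffEntropy X U μ < ⊤ ∧ condDiffEntropy (fun ω => X ω + Z ω) U μ < ⊤ ∧
      condDiffEntropy Xg Ug μ' < ⊤ ∧ condDiffEntropy (fun ω => Xg ω + Zg ω) Ug μ' < ⊤) ∧
    (0 < σsq → ⊥ < condDiffEntropy (fun ω => X ω + Z ω) U μ ∧
      ⊥ < condDiffEntropy (fun ω => Xg ω + Zg ω) Ug μ') ∧
    -- the inequality
    condDiffEntropy X U μ - condDiffEntropy (fun ω => X ω + Z ω) U μ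
      ≤ (n : EReal) * condDiffEntropy Xg Ug μ'
        - (n : EReal) * condDiffEntropy (fun ω => Xg ω + Zg ω) Ug μ' ∧
    -- equality if the pairs `(X_j, U_j)` are i.i.d. copies of `(X_g, U_g)`
    (iIndepFun (fun (j : Fin n) (ω : Ω) => (X ω j, U ω j)) μ →
      (∀ j, IdentDistrib (fun ω => (X ω j, U ω j)) (fun ω => (Xg ω, Ug ω)) μ μ') →
      condDiffEntropy X U μ - condDiffEntropy (fun ω => X ω + Z ω) U μ
        = (n : EReal) * condDiffEntropy Xg Ug μ'
          - (n : EReal) * condDiffEntropy (fun ω => Xg ω + Zg ω) Ug μ') := by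
  have hX2 := hPX.memLp hX
  have hU2 := hPU.memLp hU
  have hZ2 := fun j => memLp_of_hasLaw_gaussianReal (hZlaw j)
  have hY2 : ∀ j, MemLp (fun ω => X ω j + Z ω j) 2 μ := fun j => (hX2 j).add (hZ2 j)
  have hXZ : ∀ j, IndepFun (fun ω => X ω j) (fun ω => Z ω j) μ := fun j =>
    hZXU.symm.comp (φ := fun p : (Fin n → ℝ) × (Fin n → ℝ) => p.1 j) (ψ := fun z : Fin n → ℝ => z j)
      (by fun_prop) (by fun_prop)
  have hUZ : ∀ j, IndepFun (fun ω => U ω j) (fun ω => Z ω j) μ := fun j =>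
    hZXU.symm.comp (φ := fun p : (Fin n → ℝ) × (Fin n → ℝ) => p.2 j) (ψ := fun z : Fin n → ℝ => z j)
      (by fun_prop) (by fun_prop)
  have hZpi : μ.map Z = Measure.pi fun _ => gaussianReal 0 σsq := (hZiid.hasLaw_pi hZlaw).map_eq
  have hKpsd := posSemidef_of_covariance_le hX2 hU2 hZ2 hK
  -- the Gaussian triple
  have hG : HasGaussianLaw (fun ω => !₂[Zg ω, Xg ω + Zg ω, Ug ω]) μ' := hg.hasGaussianLaw
  have hG0 : ∫ ω, !₂[Zg ω, Xg ω + Zg ω, Ug ω] ∂μ' = 0 := by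
    rw [hg.integral_eq, integral_id_multivariateGaussian]
  have hGj : ∀ i, MemLp (fun ω => !₂[Zg ω, Xg ω + Zg ω, Ug ω] i) 2 μ' := fun i =>
    (hG.map_fun (EuclideanSpace.proj i : EuclideanSpace ℝ (Fin 3) →L[ℝ] ℝ)).memLp_two
  have hZg2 : MemLp Zg 2 μ' := hGj 0
  have hUg2 : MemLp Ug 2 μ' := hGj 2
  have hYg2 : MemLp (fun ω => Xg ω + Zg ω) 2 μ' := hGj 1
  have hXg2 : MemLp Xg 2 μ' := by
    have h := hYg2.sub hZg2
    rwa [show (fun ω => Xg ω + Zg ω) - Zg = Xg from add_sub_cancel_right Xg Zg] at h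
  have hKcov : K = covarianceMatrix (fun ω => ![Zg ω, Xg ω + Zg ω, Ug ω]) μ' := by
    ext i k
    rw [← covariance_eval_multivariateGaussian (μ := 0) hKpsd i k,
      ← hg.covariance_fun_comp (by fun_prop) (by fun_prop)]
    rfl
  have hK0 : K 0 0 = σsq := by
    rw [hKcov, ← hZg.variance_eq.trans variance_id_gaussianReal, ← covariance_self hZg.aemeasurable]
    rfl
  obtain ⟨hK1, hK2⟩ := noise_column_eq hn hX2 hZ2
    (fun j => (hXZ j).covariance_eq_zero (hX2 j) (hZ2 j))
    (fun j => (hUZ j).covariance_eq_zero (hU2 j) (hZ2 j))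
    (fun j => (hZlaw j).variance_eq.trans variance_id_gaussianReal) hK hK0
  have hVg : variance Zg μ' = σsq := hZg.variance_eq.trans variance_id_gaussianReal
  have hZUg : covariance Zg Ug μ' = 0 := by
    rw [covariance_comm, ← hK2, hKcov]; rfl
  have hZXg : covariance Zg Xg μ' = 0 := by
    have h1 : covariance (fun ω => Xg ω + Zg ω) Zg μ' = σsq := by rw [← hK1, hKcov]; rfl
    have h2 := covariance_add_left hXg2 hZg2 hZg2
    rw [covariance_self hZg.aemeasurable, hVg] at h2
    have h3 : covariance (Xg + Zg) Zg μ' = σsq := h1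
    rw [covariance_comm]
    linarith
  obtain ⟨a, v, hv, hWi, hWl, hYi, hYl⟩ := exists_gaussian_regression hG hG0 hVg hZXg hZUg
  have hsum : ∑ j, variance (fun ω => X ω j - a * U ω j) μ ≤ n * v := by
    refine (sum_variance_residual_le hn hX2 hU2 hZ2 hK a).trans_eq ?_
    rw [hKcov, covarianceMatrix_quadForm_residual hZg2 hXg2 hUg2, hv]
  have hXg : AEMeasurable Xg μ' := hXg2.aemeasurable
  have hUg : AEMeasurable Ug μ' := hUg2.aemeasurable
  -- Gaussian entropies
  have hXg' : v ≠ 0 → condDiffEntropy Xg Ug μ' = (gaussianEntropy v : EReal) := fun h0 => by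
    rw [← condDiffEntropy_add_gaussianReal hUg h0 hWi hWl a]
    simp
  have hYg' : v + σsq ≠ 0 → condDiffEntropy (fun ω => Xg ω + Zg ω) Ug μ' =
      (gaussianEntropy (v + σsq) : EReal) := fun h0 => by
    rw [← condDiffEntropy_add_gaussianReal hUg h0 hYi hYl a]
    simp
  -- A zero residual puts the pair on the line `y = a u`, whose fibres are single points.
  have hline : ∀ {Y : Ω' → ℝ}, AEMeasurable Y μ' →
      HasLaw (fun ω => Y ω - a * Ug ω) (gaussianReal 0 0) μ' → condDiffEntropy Y Ug μ' = ⊥ := by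
    intro Y hY h
    rw [gaussianReal_zero_var] at h
    refine condDiffEntropy_eq_bot_of_ae_mem hY hUg (S := {p | p.2 = a * p.1})
      (measurableSet_eq_fun (by fun_prop) (by fun_prop)) (fun u => ?_) ?_
    · exact measure_singleton (a * u)
    · filter_upwards [h.ae_eq_of_dirac] with ω hω
      exact sub_eq_zero.1 hω
  have hXg0 : v = 0 → condDiffEntropy Xg Ug μ' = ⊥ := fun h0 => hline hXg (h0 ▸ hWl)
  have hYg0 : v + σsq = 0 → condDiffEntropy (fun ω => Xg ω + Zg ω) Ug μ' = ⊥ := fun h0 =>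
    hline hYg2.aemeasurable (h0 ▸ hYl)
  have hDm : ∀ j, MemLp (fun ω => X ω j - a * U ω j) 2 μ := fun j =>
    (hX2 j).sub ((hU2 j).const_mul a)
  -- The residual variances are nonnegative with sum at most `0`. One coordinate, available as `n >
  -- 0`, already confines `X` to a null hyperplane given `U`.
  have hX0 : v = 0 → condDiffEntropy X U μ = ⊥ := fun h0 => by
    have hj : variance (fun ω => X ω ⟨0, hn⟩ - a * U ω ⟨0, hn⟩) μ = 0 := by
      refine le_antisymm ?_ (variance_nonneg _ _)
      refine (Finset.single_le_sum (f := fun j => variance (fun ω => X ω j - a * U ω j) μ)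
        (fun _ _ => variance_nonneg _ _) (Finset.mem_univ _)).trans (hsum.trans_eq ?_)
      simp [h0]
    obtain ⟨c, hc⟩ : ∃ c : ℝ, ∀ᵐ ω ∂μ, X ω ⟨0, hn⟩ - a * U ω ⟨0, hn⟩ = c :=
      ⟨_, ae_eq_integral_of_variance_eq_zero (hDm _) hj⟩
    refine condDiffEntropy_eq_bot_of_ae_mem hX.aemeasurable hU.aemeasurable
      (S := {p | p.2 ⟨0, hn⟩ = a * p.1 ⟨0, hn⟩ + c})
      (measurableSet_eq_fun (by fun_prop) (by fun_prop)) (fun u => ?_) ?_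
    · exact Measure.pi_hyperplane (fun _ : Fin n => (volume : Measure ℝ)) ⟨0, hn⟩
        (a * u ⟨0, hn⟩ + c)
    · filter_upwards [hc] with ω hω
      exact sub_eq_iff_eq_add'.1 hω
  have hnpos : (0 : EReal) < n := by exact_mod_cast hn
  have hZ0 : σsq = 0 → (fun ω => X ω + Z ω) =ᵐ[μ] X := fun h0 => by
    have h1 : ∀ j, ∀ᵐ ω ∂μ, Z ω j = 0 := fun j => by
      have := hZlaw j
      rw [h0, gaussianReal_zero_var] at this
      exact this.ae_eq_of_dirac
    filter_upwards [ae_all_iff.2 h1] with ω hω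
    ext j
    simp [hω j]
  refine ⟨⟨condDiffEntropy_lt_top_of_memLp hX.aemeasurable hU.aemeasurable hX2,
    condDiffEntropy_lt_top_of_memLp (hX.add hZ).aemeasurable hU.aemeasurable hY2, ?_, ?_⟩,
    fun hs => ⟨bot_lt_condDiffEntropy_add_gaussian hX hU hZ hZXU hs.ne' hZpi hY2, ?_⟩, ?_, ?_⟩
  · by_cases h0 : v = 0
    · rw [hXg0 h0]; exact bot_lt_top
    · rw [hXg' h0]; exact EReal.coe_lt_top _
  · by_cases h0 : v + σsq = 0
    · rw [hYg0 h0]; exact bot_lt_top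
    · rw [hYg' h0]; exact EReal.coe_lt_top _
  · rw [hYg' (by positivity)]; exact EReal.bot_lt_coe _
  · by_cases h0 : v = 0
    · rw [hX0 h0, EReal.bot_sub]; exact bot_le
    have hvs : v + σsq ≠ 0 := fun h => h0 (by simpa using (add_eq_zero.1 h).1)
    rw [hXg' h0, hYg' hvs]
    by_cases hs : σsq = 0
    -- Without noise the left side is an entropy minus itself, at most `0` even when infinite; the
    -- right side is `0` because `v ≠ 0` makes the Gaussian entropy finite.
    · rw [condDiffEntropy_congr (hZ0 hs) (Filter.EventuallyEq.refl _ U), hs, add_zero]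
      refine EReal.sub_self_le_zero.trans (le_of_eq ?_)
      rw [show (n : EReal) = ((n : ℝ) : EReal) by simp, ← EReal.coe_mul, ← EReal.coe_sub, sub_self,
        EReal.coe_zero]
    -- Including the mean of each residual in `m` turns its second moment into the variance bounded
    -- by `hsum`.
    · refine (condDiffEntropy_sub_add_gaussian_le hX hU hZ hZXU hs h0 hZpi hX2
        (m := fun u j => a * u j + ∫ ω, (X ω j - a * U ω j) ∂μ) (by fun_prop) (fun j => ?_)
        ?_).trans (le_of_eq ?_)
      · simp_rw [← sub_sub]
        exact (hDm j).sub (memLp_const _)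
      · simp_rw [← sub_sub, ← fun j => variance_eq_integral (hDm j).aemeasurable]
        simpa using hsum
      · rw [show (n : EReal) = ((n : ℝ) : EReal) by simp, ← EReal.coe_mul, ← EReal.coe_mul,
          ← EReal.coe_sub, Fintype.card_fin, gaussianEntropy, gaussianEntropy]
        congr 1
        have h1 : (0 : ℝ) < v := by positivity
        have h2 : (0 : ℝ) < (v + σsq : ℝ≥0) := by positivity
        rw [← NNReal.coe_add, Real.log_mul (by positivity) h1.ne',
          Real.log_mul (by positivity) h2.ne']
        ring
  · intro hi hd
    by_cases h0 : v = 0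
    -- Both sides are `-∞`, as `⊥` minus anything is `⊥` in `EReal`.
    · rw [hX0 h0, hXg0 h0, EReal.bot_sub, EReal.mul_bot_of_pos hnpos, EReal.bot_sub]
    have hvs : v + σsq ≠ 0 := fun h => h0 (by simpa using (add_eq_zero.1 h).1)
    obtain ⟨hDi, hDl⟩ := residual_of_iid hX hU hUg hWi hWl hi hd
    have hDmeas : Measurable fun ω => X ω - a • U ω := by fun_prop
    have hDZ : IndepFun (fun ω => (U ω, X ω - a • U ω)) Z μ :=
      hZXU.symm.comp (φ := fun p : (Fin n → ℝ) × (Fin n → ℝ) => (p.2, p.1 - a • p.2)) (ψ := id)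
        (by fun_prop) measurable_id
    have hSl := map_add_pi_gaussianReal hDmeas hZ (hDZ.comp measurable_snd measurable_id) hDl hZpi
    have hSi : IndepFun U (fun ω => X ω - a • U ω + Z ω) μ :=
      (indepFun_prodMk_of_indepFun hU hDmeas hZ hDi hDZ).comp (φ := id)
        (ψ := fun p : (Fin n → ℝ) × (Fin n → ℝ) => p.1 + p.2) measurable_id (by fun_prop)
    have h1 := condDiffEntropy_add_pi_gaussianReal hU.aemeasurable hDmeas.aemeasurable h0 hDi hDl a
    have h2 := condDiffEntropy_add_pi_gaussianReal (W := fun ω => X ω - a • U ω + Z ω)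
      hU.aemeasurable (hDmeas.add hZ).aemeasurable hvs hSi hSl a
    have e2 : (fun ω => a • U ω + (X ω - a • U ω + Z ω)) = fun ω => X ω + Z ω := by
      ext ω j; simp; ring
    simp only [add_sub_cancel] at h1
    rw [e2] at h2
    rw [hXg' h0, hYg' hvs, h1, h2, Fintype.card_fin]
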